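/- **Setting.** Let $n\ge 1$ and let $\mathfrak B_n$ be the group of signed permutations: the bijections $w$ of $\{\pm1,\dots,\pm n\}$ with $w(-i)=-w(i)$, written in one-line notation $w=w_1w_2\cdots w_n$ with $w_i=w(i)$ (negative letters are underlined, $\underline a=-a$). It is the Weyl group of type $B_n$, acting on $\mathbb R^n$ by $we_i=e_{w_i}$, where $e_{-i}=-e_i$; the positive roots are $\Phi^+=\{e_i\}\cup\{\pm e_i+e_j : i<j\}$, $\Phi=\Phi^+\cup(-\Phi^+)$, and the simple roots are $\Delta=\{\alpha_0=e_1\}\cup\{\alpha_i=-e_i+e_{i+1} : 1\le i\le n-1\}$. For $J\subseteq\Delta$ let $\Phi_J=\Phi\cap\operatorname{span}(J)$, let $W_J$ be the subgroup generated by the reflections in the roots of $J$, and for $w\in W_J$ let $I_{\Phi_J}(w)=\{\beta\in\Phi_J^+ : w\beta\in\Phi_J^-\}$. For $K\subseteq J$ and $w\in W_J$, let $w_K=w|_{\Phi_K}$ be the unique element of $W_K$ with $I_{\Phi_K}(w_K)=I_{\Phi_J}(w)\cap\operatorname{span}(K)$. An element $w\in W_J$ is *separable* (with respect to $\Phi_J$)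 if one of the following holds: $\Phi_J$ has type $A_1$; or $\Phi_J$ is not irreducible and the restriction of $w$ to each irreducible component of $\Phi_J$ is separable (so the trivial element is separable when $J=\emptyset$); or $\Phi_J$ is irreducible and there is $\alpha\in J$ such that $w|_{\Phi_{J\setminus\{\alpha\}}}$ is separable and the set $\{\beta\in\Phi_J^+ : \beta\ge\alpha\}$ is either contained in $I_{\Phi_J}(w)$ or disjoint from it, where $\beta\ge\alpha$ means that $\beta-\alpha$ is a nonnegative integral combination of the simple roots in $J$. An element $w\in\mathfrak B_n$ is *minimal non-separable* if $w$ is not separable with respect to $\Phi$, but $w_J$ is separable with respect to $\Phi_J$ for every $J\subsetneq\Delta$. For a sequence $a=a_1\cdots a_m$ of nonzero numbers, $\mathrm{sts}(a)$ is the unique $u\in\mathfrak B_m$ such that $u_i<0\Leftrightarrow a_i<0$ for all $i$, and $|u_i|<|u_j|\Leftrightarrow|a_i|\le|a_j|$ for all $i<j$. **Lemma.** Let $w=w_1w_2\cdots w_n\in\mathfrak B_n$ be minimal non-separable. Then $w^{-1}$ is minimal non-separable if and only if both of the following conditions hold: 1. there exists $i\in\{1,\dots,n-1\}$ such that $|w_i|=n$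 and $\mathrm{sts}(w_1\cdots w_{i-1}w_{i+1}\cdots w_n)\in\mathfrak B_{n-1}$ is separable; 2. for all $j,k,l$ with $1\le j<k<l<n$: if $w_n>0$, then $\mathrm{sts}(w_jw_kw_lw_n)\notin\{\underline1\,\underline4\,\underline2\,3,\ 1\,\underline4\,\underline2\,3\}$; and if $w_n<0$, then $\mathrm{sts}(w_jw_kw_lw_n)\notin\{1\,4\,2\,\underline3,\ \underline1\,4\,2\,\underline3\}$. -/

import Mathlib

namespace TypeB

/-- The set `[n]_± = {±1, …, ±n}`. -/
abbrev SignedIdx (n : ℕ) : Type := {x : ℤ // x ≠ 0 ∧ |x| ≤ n}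

/-- Negation on `[n]_±`. -/
def SignedIdx.neg {n : ℕ} (x : SignedIdx n) : SignedIdx n :=
  ⟨-x.1, by simpa using x.2.1, by simpa using x.2.2⟩

/-- The letter `i + 1 ∈ [n]` attached to the zero-based position `i`. -/
def letter {n : ℕ} (i : Fin n) : SignedIdx n :=
  ⟨(i : ℤ) + 1, by omega, by rw [abs_le]; constructor <;> omega⟩

theorem SignedIdx.neg_neg {n : ℕ} (x : SignedIdx n) : x.neg.neg = x :=
  Subtype.ext (_root_.neg_neg x.1)

/-- The group `𝔅_n` of signed permutations: the permutations `w` of `[n]_±` such that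
`w (-x) = - w x`, under composition. -/
def signedPermGroup (n : ℕ) : Subgroup (Equiv.Perm (SignedIdx n)) where
  carrier := {w | ∀ x, w x.neg = (w x).neg}
  mul_mem' := by
    intro a b ha hb x
    simp only [Set.mem_ofPred_eq] at ha hb
    simp [ha, hb]
  one_mem' := by intro x; rfl
  inv_mem' := by
    intro a ha x
    simp only [Set.mem_ofPred_eq] at ha
    rw [Equiv.Perm.inv_eq_iff_eq, ha]
    simp

abbrev SignedPerm (n : ℕ) : Type := signedPermGroup n

/-- One-line notation: `oneLine w i` is the letter `w_{i+1} = w (i + 1)`. -/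
def oneLine {n : ℕ} (w : SignedPerm n) (i : Fin n) : ℤ := (w.1 (letter i)).1

/-- The standard basis vector `e_{i+1}` of `ℝⁿ`. -/
def e {n : ℕ} (i : Fin n) : Fin n → ℝ := Pi.single i 1

/-- The vectors `e_x` for `x ∈ [n]_±`, where `e_{-i} = - e_i`. -/
def signedBasis {n : ℕ} (x : SignedIdx n) : Fin n → ℝ :=
  fun k => if x.1 = (k : ℤ) + 1 then 1 else if x.1 = -((k : ℤ) + 1) then -1 else 0

/-- The linear action of a signed permutation on `ℝⁿ`, determined by `w e_i = e_{w_i}`. -/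
def act {n : ℕ} (w : SignedPerm n) (v : Fin n → ℝ) : Fin n → ℝ :=
  ∑ i : Fin n, v i • signedBasis (w.1 (letter i))

/-- The positive roots of type `B_n`: the `e_i`, and the `±e_i + e_j` with `i < j`. -/
def posRoots (n : ℕ) : Set (Fin n → ℝ) :=
  {β | (∃ i, β = e i) ∨ ∃ i j, i < j ∧ (β = e i + e j ∨ β = -e i + e j)}

/-- The root system of type `B_n`. -/
def roots (n : ℕ) : Set (Fin n → ℝ) := {β | β ∈ posRoots n ∨ -β ∈ posRoots n}

/-- The simple roots, indexed by `0, …, n - 1`: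
`α_0 = e_1` and `α_i = -e_i + e_{i+1}` for `1 ≤ i ≤ n - 1` (one-based basis vectors). -/
def simpleRoot {n : ℕ} (i : Fin n) : Fin n → ℝ :=
  if (i : ℕ) = 0 then e i else -e ⟨(i : ℕ) - 1, by omega⟩ + e i

/-- The simple roots with index in `J`. -/
def simples {n : ℕ} (J : Finset (Fin n)) : Set (Fin n → ℝ) := {α | ∃ i ∈ J, α = simpleRoot i}

/-- The signed permutation exchanging `a` with `b` and `-a` with `-b`. -/
def signedSwap {n : ℕ} (a b : SignedIdx n) : SignedPerm n :=
  if h : b = a.neg then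
    ⟨Equiv.swap a b, by
      intro x
      subst h
      have h1 : a.neg.neg = a := a.neg_neg
      by_cases hx : x = a
      · subst hx; simp [Equiv.swap_apply_left, Equiv.swap_apply_right, h1]
      · by_cases hx' : x = a.neg
        · subst hx'; simp [Equiv.swap_apply_left, Equiv.swap_apply_right, h1]
        · have h2 : x.neg ≠ a := fun h => hx' (by rw [← h, x.neg_neg])
          have h3 : x.neg ≠ a.neg := fun h => hx (by rw [← x.neg_neg, h, h1])
          rw [Equiv.swap_apply_of_ne_of_ne hx hx', Equiv.swap_apply_of_ne_of_ne h2 h3]⟩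
  else
    ⟨Equiv.swap a b * Equiv.swap a.neg b.neg, by
      intro x
      obtain ⟨a, ha, ha'⟩ := a
      obtain ⟨b, hb, hb'⟩ := b
      obtain ⟨x, hx, hx'⟩ := x
      simp only [SignedIdx.neg, Subtype.mk.injEq] at h
      apply Subtype.ext
      simp only [SignedIdx.neg, Equiv.Perm.coe_mul, Function.comp_apply, Equiv.swap_apply_def,
        Subtype.mk.injEq]
      grind⟩

/-- The Coxeter generators `s_0 = (1, -1)` and `s_i = (i, i + 1)` for `1 ≤ i ≤ n - 1`; they are
the reflections in the simple roots with the same index. -/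
def simpleReflection {n : ℕ} (i : Fin n) : SignedPerm n :=
  if (i : ℕ) = 0 then signedSwap (letter i) (letter i).neg
  else signedSwap (letter ⟨(i : ℕ) - 1, by omega⟩) (letter i)

/-- The parabolic subgroup `W_J`, i.e. the Weyl group of `Φ_J`. -/
def parabolic {n : ℕ} (J : Finset (Fin n)) : Subgroup (SignedPerm n) :=
  Subgroup.closure {s | ∃ i ∈ J, s = simpleReflection i}

/-- The subsystem `Φ_J = Φ ∩ span J`. -/
def subroots {n : ℕ} (J : Finset (Fin n)) : Set (Fin n → ℝ) :=
  roots n ∩ (Submodule.span ℝ (simples J) : Set (Fin n → ℝ))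

/-- The positive roots of `Φ_J`. -/
def posSubroots {n : ℕ} (J : Finset (Fin n)) : Set (Fin n → ℝ) :=
  posRoots n ∩ (Submodule.span ℝ (simples J) : Set (Fin n → ℝ))

/-- The inversion set `I_{Φ_J}(w) = {β ∈ Φ_J⁺ | w β ∈ Φ_J⁻}` of `w ∈ W_J`. -/
def inversions {n : ℕ} (J : Finset (Fin n)) (w : SignedPerm n) : Set (Fin n → ℝ) :=
  {β | β ∈ posSubroots J ∧ -(act w β) ∈ posSubroots J}

/-- For `w ∈ W_J` and `K ⊆ J`: the element `v` is `w|_{Φ_K}` (also denoted `w_K`), that is,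
`v ∈ W_K` and `I_{Φ_J}(w) ∩ span K = I_{Φ_K}(v)`. -/
def IsRestriction {n : ℕ} (J : Finset (Fin n)) (w : SignedPerm n) (K : Finset (Fin n))
    (v : SignedPerm n) : Prop :=
  v ∈ parabolic K ∧
    inversions J w ∩ (Submodule.span ℝ (simples K) : Set (Fin n → ℝ)) = inversions K v

/-- A nonempty set of roots is irreducible if it is not the disjoint union of two nonempty
mutually orthogonal subsets. -/
def IrreducibleRoots {n : ℕ} (R : Set (Fin n → ℝ)) : Prop :=
  R.Nonempty ∧ ∀ S ⊆ R, S.Nonempty → (R \ S).Nonempty → ∃ a ∈ S, ∃ b ∈ R \ S, a ⬝ᵥ b ≠ 0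

/-- `Φ_K` is one of the irreducible components of `Φ_J`. -/
def IsComponent {n : ℕ} (J K : Finset (Fin n)) : Prop :=
  K ⊆ J ∧ IrreducibleRoots (subroots K) ∧
    ∀ a ∈ subroots K, ∀ b ∈ subroots J \ subroots K, a ⬝ᵥ b = 0

/-- `β ≥ α_i` in the root order of `Φ_J`: the difference `β - α_i` is a nonnegative integral
combination of the simple roots of `Φ_J`. -/
def AboveSimple {n : ℕ} (J : Finset (Fin n)) (i : Fin n) (β : Fin n → ℝ) : Prop :=
  β - simpleRoot i ∈ AddSubmonoid.closure (simples J)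

/-- `SeparableIn J w`, for `w ∈ W_J`, says that `(w, Φ_J)` is separable. The definition is
recursive:
* every element is separable if `Φ_J` is of type `A_1`;
* if `Φ_J` is not irreducible, then `w` is separable when its restrictions to all irreducible
  components of `Φ_J` are (the empty root system has no component);
* if `Φ_J` is irreducible, then `w` is separable when there is a pivot `α_i`, `i ∈ J`, such that
  `w|_{Φ_{J \ {i}}}` is separable, and the positive roots `β ≥ α_i` of `Φ_J` are all inversions of
  `w`, or none of them is. -/
inductive SeparableIn {n : ℕ} : Finset (Fin n) → SignedPerm n → Prop
  | typeA1 (i : Fin n) (w : SignedPerm n) : SeparableIn {i} w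
  | reducible (J : Finset (Fin n)) (w : SignedPerm n)
      (hJ : ¬ IrreducibleRoots (subroots J))
      (v : Finset (Fin n) → SignedPerm n)
      (hv : ∀ K, IsComponent J K → IsRestriction J w K (v K))
      (hsep : ∀ K, IsComponent J K → SeparableIn K (v K)) : SeparableIn J w
  | pivot (J : Finset (Fin n)) (w : SignedPerm n)
      (hJ : IrreducibleRoots (subroots J))
      (i : Fin n) (hi : i ∈ J) (v : SignedPerm n)
      (hv : IsRestriction J w (J.erase i) v)
      (hsep : SeparableIn (J.erase i) v)
      (hpivot : (∀ β ∈ posSubroots J, AboveSimple J i β → β ∈ inversions J w) ∨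
        (∀ β ∈ posSubroots J, AboveSimple J i β → β ∉ inversions J w)) : SeparableIn J w

/-- `w ∈ 𝔅_n` is separable. -/
def Separable {n : ℕ} (w : SignedPerm n) : Prop := SeparableIn Finset.univ w

/-- `w ∈ 𝔅_n` is minimal non-separable: it is not separable, but `w_J ∈ W_J` is separable for
every proper subset `J` of the simple roots. -/
def MinimalNonseparable {n : ℕ} (w : SignedPerm n) : Prop :=
  ¬ Separable w ∧
    ∀ J : Finset (Fin n), J ⊂ Finset.univ →
      ∃ v : SignedPerm n, IsRestriction Finset.univ w J v ∧ SeparableIn J v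

/-- The signed permutation with one-line notation `b` is the standard signed permutation
`sts(a)` of the sequence `a` of nonzero numbers. -/
def IsSts {m : ℕ} (a b : Fin m → ℤ) : Prop :=
  (∀ i, b i < 0 ↔ a i < 0) ∧ ∀ i j, i < j → (|b i| < |b j| ↔ |a i| ≤ |a j|)

end TypeB

namespace TypeB

-- The roots `-e i + e j`, `e j`, `e i + e j` are inversions of `w` according to the signs of `w_j -
-- w_i`, `w_j`, `w_i + w_j`. So separability with respect to `Φ_J` can be read off the one-line
-- word, and it amounts to `PatternSeparable`: no 2413 or 3142 among positions whose differences lie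
-- in `Φ_J`, and, along an initial segment of positions contained in `J`, no letter followed by one
-- of opposite sign and smaller absolute value. A pivot cuts the word into blocks that no forbidden
-- configuration can straddle (`PatternSeparable.of_erase`). Conversely, a word free of these
-- configurations has a pivot (`exists_pivot`), and induction on `J` finishes.
--
-- The patterns 2413 and 3142 are already visible after removing `α_0`, so a minimal non-separable
-- `w` avoids them. Its only defects are pairs of opposite sign and decreasing absolute value that
-- end at the last position (`minimalNonseparable_iff`). Inversion exchanges positions with absolute
-- values and carries such pairs to such pairs (`InverseAt.not_signedLe`). Hence `w⁻¹` has defects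
-- only at its last position exactly when every defect of `w` involves the letter of maximal
-- absolute value, which is condition 1.
--
-- It remains that `w⁻¹` avoid 2413 and 3142. A sign analysis of the four letters involved shows
-- that, given the rest, these patterns come only from the quadruples of condition 2 (`avoids_inv`).
-- Those quadruples do produce them (`not_endPattern`).

-- Coordinates in the simple roots and the positive roots of `Φ_J`.

/-- The coefficient of the simple root `α_i` in a vector. -/
def coef {n : ℕ} (i : Fin n) : (Fin n → ℝ) →ₗ[ℝ] ℝ := ∑ k ∈ Finset.Ici i, LinearMap.proj k

theorem coef_apply {n : ℕ} (i : Fin n) (v : Fin n → ℝ) : coef i v = ∑ k ∈ Finset.Ici i, v k := by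
  simp [coef]

theorem coef_e {n : ℕ} (i j : Fin n) : coef i (e j) = if i ≤ j then 1 else 0 := by
  simp [coef_apply, e]

theorem coef_simpleRoot {n : ℕ} (i j : Fin n) :
    coef i (simpleRoot j) = if i = j then 1 else 0 := by
  unfold simpleRoot
  split_ifs <;> simp only [map_add, map_neg, coef_e, Fin.le_def, Fin.ext_iff] at * <;>
    split_ifs <;> first | omega | norm_num

theorem e_eq_sum_simpleRoot {n : ℕ} (j : Fin n) : e j = ∑ i ∈ Finset.Iic j, simpleRoot i := by
  obtain ⟨j, hj⟩ := j
  induction j with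
  | zero =>
    have : Finset.Iic (⟨0, hj⟩ : Fin n) = {⟨0, hj⟩} := by
      ext x; simp [Fin.le_def, Fin.ext_iff]
    simp [this, simpleRoot]
  | succ j ih =>
    have : Finset.Iic (⟨j + 1, hj⟩ : Fin n) =
        insert ⟨j + 1, hj⟩ (Finset.Iic (⟨j, by omega⟩ : Fin n)) := by
      ext x; simp only [Finset.mem_insert, Finset.mem_Iic, Fin.le_def, Fin.ext_iff]; omega
    rw [this, Finset.sum_insert (by simp [Fin.le_def]), ← ih]
    simp [simpleRoot]

theorem sum_coef_smul_simpleRoot {n : ℕ} (v : Fin n → ℝ) :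
    ∑ i, coef i v • simpleRoot i = v := by
  have h : (∑ i : Fin n, (coef i).smulRight (simpleRoot i)) = LinearMap.id := by
    apply LinearMap.pi_ext'
    intro j
    ext1
    change (∑ i : Fin n, (coef i).smulRight (simpleRoot i)) (e j) = e j
    conv_rhs => rw [e_eq_sum_simpleRoot]
    simp only [LinearMap.sum_apply, LinearMap.smulRight_apply, coef_e, ite_smul, one_smul,
      zero_smul]
    rw [← Finset.sum_filter]
    congr 1
    ext; simp
  simpa using congrArg (fun L => L v) h

theorem mem_span_simples {n : ℕ} {J : Finset (Fin n)} {v : Fin n → ℝ} :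
    v ∈ Submodule.span ℝ (simples J) ↔ ∀ i ∉ J, coef i v = 0 := by
  constructor
  · intro hv i hi
    have : Submodule.span ℝ (simples J) ≤ LinearMap.ker (coef i) := by
      rw [Submodule.span_le]
      rintro _ ⟨j, hj, rfl⟩
      have : i ≠ j := by rintro rfl; exact hi hj
      simp [coef_simpleRoot, this]
    exact this hv
  · intro h
    rw [← sum_coef_smul_simpleRoot v]
    refine Submodule.sum_mem _ fun i _ => ?_
    by_cases hi : i ∈ J
    · exact Submodule.smul_mem _ _ (Submodule.subset_span ⟨i, hi, rfl⟩)
    · simp [h i hi]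

theorem mem_closure_simples {n : ℕ} {J : Finset (Fin n)} {v : Fin n → ℝ} (c : Fin n → ℕ)
    (hc : ∀ i, coef i v = c i) (hJ : ∀ i ∉ J, c i = 0) :
    v ∈ AddSubmonoid.closure (simples J) := by
  rw [← sum_coef_smul_simpleRoot v]
  refine AddSubmonoid.sum_mem _ fun i _ => ?_
  by_cases hi : i ∈ J
  · rw [hc, Nat.cast_smul_eq_nsmul]
    exact AddSubmonoid.nsmul_mem _ (AddSubmonoid.subset_closure (show simpleRoot i ∈ simples J from ⟨i, hi, rfl⟩)) _
  · simp [hc, hJ i hi]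

theorem coef_nonneg_of_mem_closure {n : ℕ} {J : Finset (Fin n)} {v : Fin n → ℝ}
    (hv : v ∈ AddSubmonoid.closure (simples J)) (i : Fin n) : 0 ≤ coef i v := by
  induction hv using AddSubmonoid.closure_induction with
  | mem x hx =>
    obtain ⟨j, _, rfl⟩ := hx
    rw [coef_simpleRoot]; split_ifs <;> norm_num
  | zero => simp
  | add x y _ _ hx hy => rw [map_add]; linarith

theorem exists_coef_eq_natCast {n : ℕ} {β : Fin n → ℝ} (hβ : β ∈ posRoots n) (i : Fin n) :
    ∃ m : ℕ, coef i β = m := by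
  rcases hβ with ⟨j, rfl⟩ | ⟨p, q, h, rfl | rfl⟩
  · exact ⟨if i ≤ j then 1 else 0, by simp [coef_e]⟩
  · exact ⟨(if i ≤ p then 1 else 0) + (if i ≤ q then 1 else 0), by simp [coef_e]⟩
  · refine ⟨if p < i ∧ i ≤ q then 1 else 0, ?_⟩
    simp only [map_add, map_neg, coef_e]
    split_ifs <;> first | omega | norm_num

theorem coef_nonneg {n : ℕ} {β : Fin n → ℝ} (hβ : β ∈ posRoots n) (i : Fin n) :
    0 ≤ coef i β := by
  obtain ⟨m, hm⟩ := exists_coef_eq_natCast hβ i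
  simp [hm]

/-- Positive roots have natural-number coefficients, so subtracting `α_i` keeps them nonnegative as
soon as the `i`-th one is nonzero. -/
theorem aboveSimple_iff {n : ℕ} {J : Finset (Fin n)} {β : Fin n → ℝ} (hβ : β ∈ posSubroots J)
    {i : Fin n} (hi : i ∈ J) : AboveSimple J i β ↔ 0 < coef i β := by
  constructor
  · intro h
    have := coef_nonneg_of_mem_closure h i
    rw [map_sub, coef_simpleRoot, if_pos rfl] at this
    linarith
  · intro h
    choose m hm using fun k => exists_coef_eq_natCast hβ.1 k
    refine mem_closure_simples (fun k => if k = i then m k - 1 else m k) (fun k => ?_) fun k hk => ?_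
    · rw [map_sub, coef_simpleRoot]
      by_cases hki : k = i
      · subst hki
        rw [hm, Nat.cast_pos] at h
        simp only [if_true, hm]
        rw [Nat.cast_sub h]; simp
      · simp [hki, hm]
    · have hki : k ≠ i := by rintro rfl; exact hk hi
      have := mem_span_simples.1 hβ.2 k hk
      rw [hm] at this
      simpa [hki] using this

/-- The support of a root in the basis of simple roots is an interval. -/
theorem coef_ne_zero_of_between {n : ℕ} {β : Fin n → ℝ} (hβ : β ∈ roots n) {p t q : Fin n}
    (hpt : p ≤ t) (htq : t ≤ q) (hp : coef p β ≠ 0) (hq : coef q β ≠ 0) : coef t β ≠ 0 := by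
  have key : ∀ β ∈ posRoots n, coef p β ≠ 0 → coef q β ≠ 0 → coef t β ≠ 0 := by
    rintro _ (⟨j, rfl⟩ | ⟨a, b, h, rfl | rfl⟩) <;> simp only [map_add, map_neg, coef_e] <;>
      split_ifs <;> first | omega | norm_num
  rcases hβ with h | h
  · exact key β h hp hq
  · simpa using key _ h (by simpa using hp) (by simpa using hq)

theorem simpleRoot_mem_posRoots {n : ℕ} (i : Fin n) : simpleRoot i ∈ posRoots n := by
  unfold simpleRoot
  split_ifs with h
  · exact Or.inl ⟨i, rfl⟩
  · exact Or.inr ⟨_, i, by simp [Fin.lt_def]; omega, Or.inr rfl⟩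

theorem simpleRoot_mem_subroots {n : ℕ} {J : Finset (Fin n)} {i : Fin n} (hi : i ∈ J) :
    simpleRoot i ∈ subroots J :=
  ⟨Or.inl (simpleRoot_mem_posRoots i), Submodule.subset_span ⟨i, hi, rfl⟩⟩

theorem e_mem_posSubroots {n : ℕ} {J : Finset (Fin n)} {j : Fin n} (h : ∀ t ≤ j, t ∈ J) :
    e j ∈ posSubroots J := by
  refine ⟨Or.inl ⟨j, rfl⟩, mem_span_simples.2 fun i hi => ?_⟩
  rw [coef_e, if_neg fun h' => hi (h i h')]

theorem e_add_e_mem_posSubroots {n : ℕ} {J : Finset (Fin n)} {i j : Fin n} (hij : i < j)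
    (h : ∀ t ≤ j, t ∈ J) : e i + e j ∈ posSubroots J :=
  ⟨Or.inr ⟨i, j, hij, Or.inl rfl⟩, Submodule.add_mem _
    (e_mem_posSubroots fun t ht => h t (ht.trans hij.le)).2 (e_mem_posSubroots h).2⟩

theorem neg_e_add_e_mem_posSubroots {n : ℕ} {J : Finset (Fin n)} {i j : Fin n} (hij : i < j)
    (h : ∀ t, i < t → t ≤ j → t ∈ J) : -e i + e j ∈ posSubroots J := by
  refine ⟨Or.inr ⟨i, j, hij, Or.inr rfl⟩, mem_span_simples.2 fun t ht => ?_⟩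
  have : ¬ (i < t ∧ t ≤ j) := fun h' => ht (h t h'.1 h'.2)
  simp only [map_add, map_neg, coef_e]
  split_ifs <;> first | omega | norm_num

theorem posSubroots_mono {n : ℕ} {J K : Finset (Fin n)} (h : K ⊆ J) :
    posSubroots K ⊆ posSubroots J :=
  fun _ hβ => ⟨hβ.1, mem_span_simples.2 fun i hi =>
    mem_span_simples.1 hβ.2 i fun hi' => hi (h hi')⟩

/-- Elements of `Φ_J⁺` described by positions. -/
theorem mem_posSubroots_cases {n : ℕ} {J : Finset (Fin n)} {β : Fin n → ℝ}
    (hβ : β ∈ posSubroots J) :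
    (∃ j, (∀ t ≤ j, t ∈ J) ∧ β = e j) ∨
    (∃ i j, i < j ∧ (∀ t ≤ j, t ∈ J) ∧ β = e i + e j) ∨
    (∃ i j, i < j ∧ (∀ t, i < t → t ≤ j → t ∈ J) ∧ β = -e i + e j) := by
  obtain ⟨hβ, hs⟩ := hβ
  rw [SetLike.mem_coe, mem_span_simples] at hs
  rcases hβ with ⟨j, rfl⟩ | ⟨i, j, h, rfl | rfl⟩
  · refine Or.inl ⟨j, fun t ht => ?_, rfl⟩
    by_contra h'
    simpa [coef_e, ht] using hs t h'
  · refine Or.inr (Or.inl ⟨i, j, h, fun t ht => ?_, rfl⟩)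
    by_contra h'
    have := hs t h'
    simp only [map_add, coef_e, if_pos ht] at this
    split_ifs at this <;> norm_num at this
  · refine Or.inr (Or.inr ⟨i, j, h, fun t hit ht => ?_, rfl⟩)
    by_contra h'
    have := hs t h'
    simp [coef_e, if_pos ht, not_le.2 hit] at this

-- A positivity functional and the action of signed permutations on roots.

/-- The linear functional with value `k` on `e_k`; it is positive on positive roots. -/
def ht {n : ℕ} : (Fin n → ℝ) →ₗ[ℝ] ℝ := ∑ k : Fin n, ((k : ℝ) + 1) • LinearMap.proj k

theorem ht_apply {n : ℕ} (v : Fin n → ℝ) : ht v = ∑ k : Fin n, ((k : ℝ) + 1) * v k := by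
  simp [ht]

theorem ht_e {n : ℕ} (k : Fin n) : ht (e k) = (k : ℝ) + 1 := by
  simp [ht_apply, e, Pi.single_apply]

theorem ht_pos {n : ℕ} {β : Fin n → ℝ} (hβ : β ∈ posRoots n) : 0 < ht β := by
  rcases hβ with ⟨j, rfl⟩ | ⟨i, j, h, rfl | rfl⟩
  · rw [ht_e]; positivity
  · rw [map_add, ht_e, ht_e]; positivity
  · have : (i : ℝ) < j := by exact_mod_cast h
    rw [map_add, map_neg, ht_e, ht_e]; linarith

theorem ht_ne_zero {n : ℕ} {β : Fin n → ℝ} (hβ : β ∈ roots n) : ht β ≠ 0 := by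
  rcases hβ with h | h
  · exact (ht_pos h).ne'
  · have := ht_pos h
    rw [map_neg] at this
    linarith

theorem neg_mem_posRoots_iff {n : ℕ} {β : Fin n → ℝ} (hβ : β ∈ roots n) :
    -β ∈ posRoots n ↔ ht β < 0 := by
  constructor
  · intro h
    have := ht_pos h
    rw [map_neg] at this
    linarith
  · intro h
    rcases hβ with h' | h'
    · linarith [ht_pos h']
    · exact h'

theorem mem_posRoots_iff {n : ℕ} {β : Fin n → ℝ} (hβ : β ∈ roots n) :
    β ∈ posRoots n ↔ 0 < ht β := by
  refine ⟨ht_pos, fun h => ?_⟩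
  rcases hβ with h' | h'
  · exact h'
  · have := ht_pos h'
    rw [map_neg] at this
    linarith

theorem neg_mem_roots {n : ℕ} {β : Fin n → ℝ} (hβ : β ∈ roots n) : -β ∈ roots n := by
  rcases hβ with h | h
  · exact Or.inr (by simpa using h)
  · exact Or.inl h

theorem signedBasis_letter {n : ℕ} (k : Fin n) : signedBasis (letter k) = e k := by
  funext j
  rw [e, Pi.single_apply]
  by_cases h : j = k
  · subst h; simp [signedBasis, letter]
  · have h' : (k : ℕ) ≠ j := fun h' => h (Fin.ext h'.symm)
    have h1 : ¬ ((k : ℤ) + 1 = (j : ℤ) + 1) := by omega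
    have h2 : ¬ ((k : ℤ) + 1 = -((j : ℤ) + 1)) := by omega
    simp only [signedBasis, letter, h, h1, h2, if_false]

theorem signedBasis_neg {n : ℕ} (x : SignedIdx n) : signedBasis x.neg = -signedBasis x := by
  funext j
  simp only [signedBasis, SignedIdx.neg, Pi.neg_apply, neg_inj]
  by_cases h1 : x.1 = (j : ℤ) + 1
  · have h2 : ¬ (-x.1 = (j : ℤ) + 1) := by omega
    rw [if_pos h1, if_neg h2, if_pos h1]
  · by_cases h2 : x.1 = -((j : ℤ) + 1)
    · have h3 : -x.1 = (j : ℤ) + 1 := by omega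
      rw [if_pos h3, if_neg h1, if_pos h2, neg_neg]
    · have h3 : ¬ (-x.1 = (j : ℤ) + 1) := by omega
      simp only [h1, h2, h3, if_false, neg_zero]

theorem eq_letter_or_neg {n : ℕ} (x : SignedIdx n) :
    ∃ k : Fin n, x = letter k ∨ x = (letter k).neg := by
  obtain ⟨x, hx, hx'⟩ := x
  rw [abs_le] at hx'
  refine ⟨⟨x.natAbs - 1, by omega⟩, ?_⟩
  rcases lt_or_gt_of_ne hx with h | h
  · right
    apply Subtype.ext
    simp only [letter, SignedIdx.neg]
    omega
  · left
    apply Subtype.ext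
    simp only [letter]
    omega

theorem letter_ne_neg {n : ℕ} (i j : Fin n) : letter i ≠ (letter j).neg := by
  intro h
  have := congrArg Subtype.val h
  simp only [letter, SignedIdx.neg] at this
  omega

theorem letter_injective {n : ℕ} : Function.Injective (letter (n := n)) := by
  intro i j h
  have := congrArg Subtype.val h
  simp only [letter] at this
  omega

theorem ht_signedBasis {n : ℕ} (x : SignedIdx n) : ht (signedBasis x) = (x.1 : ℝ) := by
  obtain ⟨k, rfl | rfl⟩ := eq_letter_or_neg x
  · rw [signedBasis_letter, ht_e]; simp [letter]
  · rw [signedBasis_neg, signedBasis_letter, map_neg, ht_e]; simp [letter, SignedIdx.neg]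

theorem act_neg_apply {n : ℕ} (w : SignedPerm n) (x : SignedIdx n) : w.1 x.neg = (w.1 x).neg :=
  w.2 x

/-- The action of a signed permutation as a linear map. -/
def actLin {n : ℕ} (w : SignedPerm n) : (Fin n → ℝ) →ₗ[ℝ] (Fin n → ℝ) where
  toFun := act w
  map_add' u v := by simp [act, add_smul, Finset.sum_add_distrib]
  map_smul' c v := by simp [act, mul_smul, Finset.smul_sum]

theorem act_add {n : ℕ} (w : SignedPerm n) (u v : Fin n → ℝ) :
    act w (u + v) = act w u + act w v := (actLin w).map_add u v

theorem act_neg {n : ℕ} (w : SignedPerm n) (v : Fin n → ℝ) :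
    act w (-v) = -act w v := (actLin w).map_neg v

theorem act_sub {n : ℕ} (w : SignedPerm n) (u v : Fin n → ℝ) :
    act w (u - v) = act w u - act w v := (actLin w).map_sub u v

theorem act_smul {n : ℕ} (w : SignedPerm n) (c : ℝ) (v : Fin n → ℝ) :
    act w (c • v) = c • act w v := (actLin w).map_smul c v

theorem act_e {n : ℕ} (w : SignedPerm n) (i : Fin n) :
    act w (e i) = signedBasis (w.1 (letter i)) := by
  simp [act, e, Pi.single_apply]

theorem act_signedBasis {n : ℕ} (w : SignedPerm n) (x : SignedIdx n) :
    act w (signedBasis x) = signedBasis (w.1 x) := by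
  obtain ⟨k, rfl | rfl⟩ := eq_letter_or_neg x
  · rw [signedBasis_letter, act_e]
  · rw [signedBasis_neg, act_neg, signedBasis_letter, act_e, act_neg_apply, signedBasis_neg]

theorem act_mul {n : ℕ} (a b : SignedPerm n) (v : Fin n → ℝ) :
    act (a * b) v = act a (act b v) := by
  change _ = actLin a (∑ i : Fin n, v i • signedBasis (b.1 (letter i)))
  rw [map_sum, act]
  refine Finset.sum_congr rfl fun i _ => ?_
  rw [map_smul]
  exact congrArg (v i • ·) (act_signedBasis a _).symm

theorem act_one {n : ℕ} (v : Fin n → ℝ) : act 1 v = v := by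
  funext j
  simp [act, signedBasis_letter, e, Pi.single_apply]

theorem ht_act_e {n : ℕ} (w : SignedPerm n) (i : Fin n) : ht (act w (e i)) = oneLine w i := by
  rw [act_e, ht_signedBasis, oneLine]

theorem signedBasis_mem_roots {n : ℕ} (x : SignedIdx n) : signedBasis x ∈ roots n := by
  obtain ⟨k, rfl | rfl⟩ := eq_letter_or_neg x
  · rw [signedBasis_letter]; exact Or.inl (Or.inl ⟨k, rfl⟩)
  · rw [signedBasis_neg, signedBasis_letter]
    exact neg_mem_roots (Or.inl (Or.inl ⟨k, rfl⟩))

theorem e_add_e_mem_roots {n : ℕ} {i j : Fin n} (h : i ≠ j) : e i + e j ∈ roots n := by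
  rcases lt_or_gt_of_ne h with h | h
  · exact Or.inl (Or.inr ⟨i, j, h, Or.inl rfl⟩)
  · exact Or.inl (Or.inr ⟨j, i, h, Or.inl (add_comm _ _)⟩)

theorem neg_e_add_e_mem_roots {n : ℕ} {i j : Fin n} (h : i ≠ j) : -e i + e j ∈ roots n := by
  rcases lt_or_gt_of_ne h with h | h
  · exact Or.inl (Or.inr ⟨i, j, h, Or.inr rfl⟩)
  · exact Or.inr (Or.inr ⟨j, i, h, Or.inr (by abel)⟩)

theorem signedBasis_add_mem_roots {n : ℕ} {x y : SignedIdx n} (h : x ≠ y) (h' : x ≠ y.neg) :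
    signedBasis x + signedBasis y ∈ roots n := by
  obtain ⟨i, rfl | rfl⟩ := eq_letter_or_neg x <;> obtain ⟨j, rfl | rfl⟩ := eq_letter_or_neg y <;>
    simp only [signedBasis_neg, signedBasis_letter, SignedIdx.neg_neg] at * <;>
    have hij : i ≠ j := by rintro rfl; simp_all
  · exact e_add_e_mem_roots hij
  · rw [add_comm]; exact neg_e_add_e_mem_roots hij.symm
  · exact neg_e_add_e_mem_roots hij
  · rw [← neg_add]; exact neg_mem_roots (e_add_e_mem_roots hij)

theorem act_mem_roots {n : ℕ} (w : SignedPerm n) {β : Fin n → ℝ} (hβ : β ∈ roots n) :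
    act w β ∈ roots n := by
  have key : ∀ β ∈ posRoots n, act w β ∈ roots n := by
    rintro _ (⟨j, rfl⟩ | ⟨i, j, h, rfl | rfl⟩)
    · rw [act_e]; exact signedBasis_mem_roots _
    · rw [act_add, act_e, act_e]
      refine signedBasis_add_mem_roots (fun h' => ?_) fun h' => ?_
      · exact h.ne (letter_injective (w.1.injective h'))
      · rw [← act_neg_apply] at h'
        exact letter_ne_neg _ _ (w.1.injective h')
    · rw [act_add, act_neg, act_e, act_e, ← signedBasis_neg, ← act_neg_apply]
      refine signedBasis_add_mem_roots (fun h' => ?_) fun h' => ?_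
      · exact letter_ne_neg _ _ (w.1.injective h').symm
      · rw [← act_neg_apply] at h'
        have := congrArg SignedIdx.neg (w.1.injective h')
        rw [SignedIdx.neg_neg, SignedIdx.neg_neg] at this
        exact h.ne (letter_injective this)
  rcases hβ with h | h
  · exact key β h
  · have := neg_mem_roots (key _ h)
    rwa [act_neg, neg_neg] at this

/-- The signed permutation `w` stabilizes the span of the simple roots in `J`. -/
def Stabilizes {n : ℕ} (J : Finset (Fin n)) (w : SignedPerm n) : Prop :=
  ∀ v ∈ Submodule.span ℝ (simples J), act w v ∈ Submodule.span ℝ (simples J)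

theorem stabilizes_univ {n : ℕ} (w : SignedPerm n) : Stabilizes Finset.univ w :=
  fun _ _ => mem_span_simples.2 fun i hi => absurd (Finset.mem_univ i) hi

theorem mem_inversions {n : ℕ} {J : Finset (Fin n)} {w : SignedPerm n} (hw : Stabilizes J w)
    {β : Fin n → ℝ} : β ∈ inversions J w ↔ β ∈ posSubroots J ∧ ht (act w β) < 0 := by
  refine and_congr_right fun hβ => ?_
  rw [← neg_mem_posRoots_iff (act_mem_roots w (Or.inl hβ.1))]
  exact ⟨fun h => h.1, fun h => ⟨h, Submodule.neg_mem _ (hw _ hβ.2)⟩⟩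

-- Simple reflections, parabolic subgroups and existence of restrictions.

/-- The coefficient `c` with `s_i v = v - c α_i`. -/
def coroot {n : ℕ} (i : Fin n) (v : Fin n → ℝ) : ℝ :=
  if (i : ℕ) = 0 then 2 * v i else v i - v ⟨(i : ℕ) - 1, by omega⟩

theorem signedSwap_apply {n : ℕ} {a b : SignedIdx n} (h : b ≠ a.neg) (x : SignedIdx n) :
    (signedSwap a b).1 x = Equiv.swap a b (Equiv.swap a.neg b.neg x) := by
  simp [signedSwap, h]

theorem signedSwap_neg_apply {n : ℕ} (a : SignedIdx n) (x : SignedIdx n) :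
    (signedSwap a a.neg).1 x = Equiv.swap a a.neg x := by
  simp [signedSwap]

theorem act_simpleReflection {n : ℕ} (i : Fin n) (v : Fin n → ℝ) :
    act (simpleReflection i) v = v - coroot i v • simpleRoot i := by
  have h : actLin (simpleReflection i) = LinearMap.id -
      (if (i : ℕ) = 0 then (2 : ℝ) • LinearMap.proj (R := ℝ) (φ := fun _ : Fin n => ℝ) i
        else LinearMap.proj i - LinearMap.proj ⟨(i : ℕ) - 1, by omega⟩).smulRight
        (simpleRoot i) := by
    apply LinearMap.pi_ext'
    intro j
    ext1
    change act (simpleReflection i) (e j) = e j - (_ : ℝ) • simpleRoot i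
    rw [act_e]
    by_cases hi : (i : ℕ) = 0
    · simp only [simpleReflection, simpleRoot, hi, if_true, signedSwap_neg_apply]
      by_cases hj : j = i
      · subst hj
        rw [Equiv.swap_apply_left, signedBasis_neg, signedBasis_letter]
        change -e j = e j - ((2 : ℝ) * (e j : Fin n → ℝ) j) • e j
        rw [show (e j : Fin n → ℝ) j = 1 by simp [e]]
        module
      · rw [Equiv.swap_apply_of_ne_of_ne (fun h => hj (letter_injective h)) (letter_ne_neg _ _),
          signedBasis_letter]
        simp [hj]
    · have hne : (⟨(i : ℕ) - 1, by omega⟩ : Fin n) ≠ i := by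
        simp only [ne_eq, Fin.ext_iff]; omega
      simp only [simpleReflection, simpleRoot, hi, if_false]
      generalize (⟨(i : ℕ) - 1, by omega⟩ : Fin n) = p at hne ⊢
      rw [signedSwap_apply (letter_ne_neg _ _), Equiv.swap_apply_of_ne_of_ne
        (letter_ne_neg _ _) (letter_ne_neg _ _)]
      by_cases hj : j = i
      · subst hj
        rw [Equiv.swap_apply_right, signedBasis_letter]
        simp [hne]
      · by_cases hj' : j = p
        · subst hj'
          rw [Equiv.swap_apply_left, signedBasis_letter]
          simp [hne]
        · rw [Equiv.swap_apply_of_ne_of_ne (fun h => hj' (letter_injective h))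
            (fun h => hj (letter_injective h)), signedBasis_letter]
          simp [hj, hj']
  have := congrArg (fun L => L v) h
  change act (simpleReflection i) v = _ at this
  rw [this]
  unfold coroot
  split_ifs <;> simp

theorem act_sub_mem_span {n : ℕ} {J : Finset (Fin n)} {w : SignedPerm n} (hw : w ∈ parabolic J)
    (v : Fin n → ℝ) : act w v - v ∈ Submodule.span ℝ (simples J) := by
  induction hw using Subgroup.closure_induction generalizing v with
  | mem x hx =>
    obtain ⟨i, hi, rfl⟩ := hx
    rw [act_simpleReflection, sub_sub_cancel_left]
    exact Submodule.neg_mem _ (Submodule.smul_mem _ _ (Submodule.subset_span ⟨i, hi, rfl⟩))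
  | one => simp [act_one]
  | mul x y _ _ hx hy =>
    have := Submodule.add_mem _ (hx (act y v)) (hy v)
    rwa [sub_add_sub_cancel, ← act_mul] at this
  | inv x _ hx =>
    have := Submodule.neg_mem _ (hx (act x⁻¹ v))
    rwa [← act_mul, mul_inv_cancel, act_one, neg_sub] at this

theorem stabilizes_of_mem_parabolic {n : ℕ} {J : Finset (Fin n)} {w : SignedPerm n}
    (hw : w ∈ parabolic J) : Stabilizes J w := fun v hv => by
  simpa using Submodule.add_mem _ (act_sub_mem_span hw v) hv

theorem e_mem_inversions {n : ℕ} {J : Finset (Fin n)} {w : SignedPerm n} (hw : Stabilizes J w)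
    {j : Fin n} (h : ∀ t ≤ j, t ∈ J) : e j ∈ inversions J w ↔ oneLine w j < 0 := by
  rw [mem_inversions hw, ht_act_e, and_iff_right (e_mem_posSubroots h)]
  norm_cast

theorem e_add_e_mem_inversions {n : ℕ} {J : Finset (Fin n)} {w : SignedPerm n}
    (hw : Stabilizes J w) {i j : Fin n} (hij : i < j) (h : ∀ t ≤ j, t ∈ J) :
    e i + e j ∈ inversions J w ↔ oneLine w i + oneLine w j < 0 := by
  rw [mem_inversions hw, act_add, map_add, ht_act_e, ht_act_e,
    and_iff_right (e_add_e_mem_posSubroots hij h)]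
  norm_cast

theorem neg_e_add_e_mem_inversions {n : ℕ} {J : Finset (Fin n)} {w : SignedPerm n}
    (hw : Stabilizes J w) {i j : Fin n} (hij : i < j) (h : ∀ t, i < t → t ≤ j → t ∈ J) :
    -e i + e j ∈ inversions J w ↔ oneLine w j < oneLine w i := by
  rw [mem_inversions hw, act_add, act_neg, map_add, map_neg, ht_act_e, ht_act_e,
    and_iff_right (neg_e_add_e_mem_posSubroots hij h), neg_add_lt_iff_lt_add, add_zero]
  norm_cast

/-- Restrictions exist. -/
theorem exists_isRestriction {n : ℕ} {J K : Finset (Fin n)} {w : SignedPerm n}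
    (hw : Stabilizes J w) (hKJ : K ⊆ J) : ∃ v, IsRestriction J w K v := by
  classical
  have : Finite (SignedIdx n) := by
    refine Set.Finite.subset (Set.finite_Icc (-n : ℤ) n) ?_
    rintro x ⟨_, hx⟩
    exact abs_le.1 hx
  -- All that matters about `ρ` is strict dominance: every `coroot i ρ` is positive.
  let ρ : Fin n → ℝ := fun k => (k : ℝ) + 1
  -- If `w v⁻¹` made some `α_i` with `i ∈ K` negative, then `w v⁻¹ s_i` would send `ρ` higher. The
  -- maximizer is therefore the coset representative that keeps `Φ_K⁺` positive.
  obtain ⟨⟨v, hv⟩, hmax⟩ := Finite.exists_max fun v : parabolic K => ht (act (w * v.1⁻¹) ρ)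
  have hx : ∀ i ∈ K, 0 ≤ ht (act (w * v⁻¹) (simpleRoot i)) := by
    intro i hi
    by_contra! hneg
    have hs : simpleReflection i ∈ parabolic K := Subgroup.subset_closure ⟨i, hi, rfl⟩
    have := hmax ⟨(simpleReflection i)⁻¹ * v, Subgroup.mul_mem _ (Subgroup.inv_mem _ hs) hv⟩
    simp only [mul_inv_rev, inv_inv] at this
    rw [← mul_assoc, act_mul _ (simpleReflection i), act_simpleReflection, act_sub, act_smul,
      map_sub, map_smul, smul_eq_mul] at this
    have hc : 0 < coroot i ρ := by
      unfold coroot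
      split_ifs with h0
      · simp only [ρ]; positivity
      · have : (((i : ℕ) - 1 : ℕ) : ℝ) < (i : ℕ) := by
          exact_mod_cast Nat.sub_lt (by omega) one_pos
        simp only [ρ]; linarith
    nlinarith
  have hx' : ∀ β ∈ posSubroots K, 0 < ht (act (w * v⁻¹) β) := by
    intro β hβ
    refine lt_of_le_of_ne ?_ (ht_ne_zero (act_mem_roots _ (Or.inl hβ.1))).symm
    have : ht (act (w * v⁻¹) β) = ∑ i, coef i β * ht (act (w * v⁻¹) (simpleRoot i)) := by
      conv_lhs => rw [← sum_coef_smul_simpleRoot β]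
      change ht (actLin _ _) = _
      simp only [map_sum, map_smul, smul_eq_mul]
      rfl
    rw [this]
    refine Finset.sum_nonneg fun i _ => ?_
    by_cases hi : i ∈ K
    · exact mul_nonneg (coef_nonneg hβ.1 i) (hx i hi)
    · rw [mem_span_simples.1 hβ.2 i hi, zero_mul]
  have hvs := stabilizes_of_mem_parabolic hv
  refine ⟨v, hv, Set.ext fun β => ?_⟩
  -- Since `w v⁻¹` preserves signs on `Φ_K`, applying it after `v` changes no sign.
  have key : ∀ β ∈ posSubroots K, (ht (act w β) < 0 ↔ ht (act v β) < 0) := by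
    intro β hβ
    have hr := act_mem_roots v (Or.inl hβ.1 : β ∈ roots n)
    have hs := hvs β hβ.2
    have hw' : act w β = act (w * v⁻¹) (act v β) := by rw [← act_mul, inv_mul_cancel_right]
    rw [hw']
    constructor
    · intro h
      by_contra h'
      have := hx' _ ⟨(mem_posRoots_iff hr).2
        (lt_of_le_of_ne (not_lt.1 h') (ht_ne_zero hr).symm), hs⟩
      linarith
    · intro h
      have := hx' _ ⟨(neg_mem_posRoots_iff hr).2 h, Submodule.neg_mem _ hs⟩
      rw [act_neg, map_neg] at this
      linarith
  rw [Set.mem_inter_iff, mem_inversions hw, mem_inversions hvs]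
  constructor
  · rintro ⟨⟨h1, h2⟩, h3⟩
    exact ⟨⟨h1.1, h3⟩, (key β ⟨h1.1, h3⟩).1 h2⟩
  · rintro ⟨h1, h2⟩
    exact ⟨⟨posSubroots_mono hKJ h1, (key β h1).2 h2⟩, h1.2⟩

-- Irreducible components as intervals of the Dynkin path.

theorem simpleRoot_dotProduct_eq_zero {n : ℕ} {i j : Fin n} (h : (i : ℕ) + 1 < j) :
    simpleRoot i ⬝ᵥ simpleRoot j = 0 := by
  have hj : (j : ℕ) ≠ 0 := by omega
  have h1 : (⟨(j : ℕ) - 1, by omega⟩ : Fin n) ≠ i := by simp only [ne_eq, Fin.ext_iff]; omega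
  have h2 : j ≠ i := by rintro rfl; omega
  by_cases hi : (i : ℕ) = 0
  · simp [simpleRoot, hi, hj, e, h1.symm, h2.symm]
  · have h3 : (⟨(j : ℕ) - 1, by omega⟩ : Fin n) ≠ ⟨(i : ℕ) - 1, by omega⟩ := by
      simp only [ne_eq, Fin.ext_iff]; omega
    have h4 : j ≠ ⟨(i : ℕ) - 1, by omega⟩ := by simp only [ne_eq, Fin.ext_iff]; omega
    simp [simpleRoot, hi, hj, e, h1, h2, h3, h4]

theorem simpleRoot_dotProduct_ne_zero {n : ℕ} {i j : Fin n} (h : (i : ℕ) + 1 = j) :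
    simpleRoot i ⬝ᵥ simpleRoot j ≠ 0 := by
  have hj : (j : ℕ) ≠ 0 := by omega
  have h1 : (⟨(j : ℕ) - 1, by omega⟩ : Fin n) = i := by simp only [Fin.ext_iff]; omega
  have h2 : j ≠ i := by rintro rfl; omega
  by_cases hi : (i : ℕ) = 0
  · simp [simpleRoot, hi, hj, e, h1, h2.symm]
  · have h3 : (⟨(i : ℕ) - 1, by omega⟩ : Fin n) ≠ i := by
      simp only [ne_eq, Fin.ext_iff]; omega
    have h4 : j ≠ ⟨(i : ℕ) - 1, by omega⟩ := by simp only [ne_eq, Fin.ext_iff]; omega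
    simp [simpleRoot, hi, hj, e, h1, h2, h3.symm, h4]

theorem dotProduct_eq_sum_coef {n : ℕ} (u v : Fin n → ℝ) :
    u ⬝ᵥ v = ∑ i, coef i v * (u ⬝ᵥ simpleRoot i) := by
  conv_lhs => rw [← sum_coef_smul_simpleRoot v]
  simp [dotProduct_sum, dotProduct_smul]

theorem ne_zero_of_mem_roots {n : ℕ} {β : Fin n → ℝ} (hβ : β ∈ roots n) : β ≠ 0 := by
  rintro rfl
  exact ht_ne_zero hβ (map_zero _)

/-- Neighbouring simple roots are not orthogonal, so an orthogonal splitting keeps all simple roots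
of an interval on one side. Every root then follows a simple root to which it is not orthogonal. -/
theorem irreducibleRoots_of_ordConnected {n : ℕ} {J : Finset (Fin n)} (hne : J.Nonempty)
    (hJ : ∀ a ∈ J, ∀ b ∈ J, ∀ t, a ≤ t → t ≤ b → t ∈ J) : IrreducibleRoots (subroots J) := by
  obtain ⟨i₀, hi₀⟩ := hne
  refine ⟨⟨_, simpleRoot_mem_subroots hi₀⟩, fun S hS hSne hTne => ?_⟩
  by_contra! horth
  have step : ∀ i ∈ J, ∀ β ∈ subroots J, β ⬝ᵥ simpleRoot i ≠ 0 → (β ∈ S ↔ simpleRoot i ∈ S) := by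
    intro i hi β hβ hne
    constructor
    · intro h
      by_contra h'
      exact hne (horth _ h _ ⟨simpleRoot_mem_subroots hi, h'⟩)
    · intro h
      by_contra h'
      exact hne (by rw [dotProduct_comm]; exact horth _ h _ ⟨hβ, h'⟩)
  have adj : ∀ d : ℕ, ∀ i ∈ J, ∀ j ∈ J, (i : ℕ) + d = j →
      (simpleRoot i ∈ S ↔ simpleRoot j ∈ S) := by
    intro d
    induction d with
    | zero => intro i _ j _ h; rw [show i = j from Fin.ext h]
    | succ d ih =>
      intro i hi j hj h
      have hk : (⟨(i : ℕ) + d, by omega⟩ : Fin n) ∈ J :=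
        hJ i hi j hj _ (Fin.le_def.2 (by simp)) (Fin.le_def.2 (by simp; omega))
      exact (ih i hi _ hk rfl).trans (step j hj _ (simpleRoot_mem_subroots hk)
        (simpleRoot_dotProduct_ne_zero (by simp only; omega)))
  have all : ∀ i ∈ J, ∀ j ∈ J, (simpleRoot i ∈ S ↔ simpleRoot j ∈ S) := by
    intro i hi j hj
    rcases le_total i j with h | h
    · exact adj (j - i) i hi j hj (by have := Fin.le_def.1 h; omega)
    · exact (adj (i - j) j hj i hi (by have := Fin.le_def.1 h; omega)).symm
  -- A root orthogonal to all simple roots of `J` would be orthogonal to itself.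
  have reach : ∀ β ∈ subroots J, ∃ i ∈ J, β ⬝ᵥ simpleRoot i ≠ 0 := by
    intro β hβ
    by_contra! h
    refine ne_zero_of_mem_roots hβ.1 (dotProduct_self_eq_zero.1 ?_)
    rw [dotProduct_eq_sum_coef]
    refine Finset.sum_eq_zero fun i _ => ?_
    by_cases hi : i ∈ J
    · rw [h i hi, mul_zero]
    · rw [mem_span_simples.1 hβ.2 i hi, zero_mul]
  obtain ⟨a, ha⟩ := hSne
  obtain ⟨b, hb, hb'⟩ := hTne
  obtain ⟨i, hi, hai⟩ := reach a (hS ha)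
  obtain ⟨j, hj, hbj⟩ := reach b hb
  exact hb' ((step j hj b hb hbj).2 ((all i hi j hj).1 ((step i hi a (hS ha) hai).1 ha)))

theorem dotProduct_eq_zero_of_coef {n : ℕ} {u v : Fin n → ℝ}
    (h : ∀ i j, coef i u ≠ 0 → coef j v ≠ 0 → simpleRoot i ⬝ᵥ simpleRoot j = 0) :
    u ⬝ᵥ v = 0 := by
  rw [dotProduct_eq_sum_coef]
  refine Finset.sum_eq_zero fun j _ => ?_
  by_cases hj : coef j v = 0
  · rw [hj, zero_mul]
  rw [dotProduct_comm, dotProduct_eq_sum_coef, Finset.sum_eq_zero, mul_zero]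
  intro i _
  by_cases hi : coef i u = 0
  · rw [hi, zero_mul]
  · rw [dotProduct_comm, h i j hi hj, mul_zero]

theorem mem_of_coef_ne_zero {n : ℕ} {J : Finset (Fin n)} {β : Fin n → ℝ} (hβ : β ∈ subroots J)
    {i : Fin n} (h : coef i β ≠ 0) : i ∈ J := by
  by_contra h'
  exact h (mem_span_simples.1 hβ.2 i h')

theorem exists_coef_ne_zero {n : ℕ} {β : Fin n → ℝ} (hβ : β ∈ roots n) :
    ∃ i, coef i β ≠ 0 := by
  by_contra! h
  refine ne_zero_of_mem_roots hβ ?_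
  rw [← sum_coef_smul_simpleRoot β]
  simp [h]

theorem ordConnected_of_irreducibleRoots {n : ℕ} {J : Finset (Fin n)}
    (hJ : IrreducibleRoots (subroots J)) :
    J.Nonempty ∧ ∀ a ∈ J, ∀ b ∈ J, ∀ t, a ≤ t → t ≤ b → t ∈ J := by
  constructor
  · obtain ⟨⟨β, hβ⟩, _⟩ := hJ
    obtain ⟨i, hi⟩ := exists_coef_ne_zero hβ.1
    exact ⟨i, mem_of_coef_ne_zero hβ hi⟩
  · intro a ha b hb t hat htb
    by_contra ht
    have hat' : a < t := lt_of_le_of_ne hat (by rintro rfl; exact ht ha)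
    have htb' : t < b := lt_of_le_of_ne htb (by rintro rfl; exact ht hb)
    -- The splitting set consists of the roots supported below the gap `t`. Supports are intervals,
    -- so every other root of `Φ_J` is supported strictly above `t`.
    obtain ⟨u, hu, v, hv, huv⟩ := hJ.2 {β ∈ subroots J | ∀ i, coef i β ≠ 0 → i < t}
      (fun _ h => h.1) ⟨simpleRoot a, simpleRoot_mem_subroots ha, fun i hi => by
        rw [coef_simpleRoot] at hi
        rw [show i = a by by_contra h; simp [h] at hi]
        exact hat'⟩ ⟨simpleRoot b, simpleRoot_mem_subroots hb, fun h => by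
          have := h.2 b (by simp [coef_simpleRoot])
          exact absurd htb' this.asymm⟩
    refine huv (dotProduct_eq_zero_of_coef fun i j hi hj => ?_)
    have hit := hu.2 i hi
    obtain ⟨k, hk, hkt⟩ : ∃ k, coef k v ≠ 0 ∧ t ≤ k := by
      by_contra! h
      exact hv.2 ⟨hv.1, h⟩
    have htj : t < j := by
      by_contra! h
      exact ht (mem_of_coef_ne_zero hv.1 (coef_ne_zero_of_between hv.1.1 h hkt hj hk))
    rw [Fin.lt_def] at hit htj
    exact simpleRoot_dotProduct_eq_zero (by omega)

/-- Every nonempty interval of `J` is contained in an irreducible component of `Φ_J`. -/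
theorem exists_isComponent {n : ℕ} {J : Finset (Fin n)} {p s : Fin n} (hps : p ≤ s)
    (h : ∀ t, p ≤ t → t ≤ s → t ∈ J) :
    ∃ K, IsComponent J K ∧ ∀ t, p ≤ t → t ≤ s → t ∈ K := by
  classical
  -- `K` is the set of indices joined to `p` inside `J`; one of the two clauses is vacuous unless `x
  -- = p`.
  let K := J.filter fun x => ∀ t, (p ≤ t → t ≤ x → t ∈ J) ∧ (x ≤ t → t ≤ p → t ∈ J)
  have hK : ∀ x, x ∈ K ↔ x ∈ J ∧ ∀ t, (p ≤ t → t ≤ x → t ∈ J) ∧ (x ≤ t → t ≤ p → t ∈ J) := by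
    intro x; simp [K]
  have hpK : p ∈ K := (hK p).2 ⟨h p le_rfl hps, fun t =>
    ⟨fun h1 h2 => h t h1 (h2.trans hps), fun h1 h2 => h t h1 (h2.trans hps)⟩⟩
  have hconn : ∀ a ∈ K, ∀ t, (∀ u, a ≤ u → u ≤ t → u ∈ J) → (∀ u, t ≤ u → u ≤ a → u ∈ J) →
      t ∈ K := by
    intro a ha t h1 h2
    obtain ⟨haJ, ha⟩ := (hK a).1 ha
    refine (hK t).2 ⟨?_, fun u => ⟨fun h3 h4 => ?_, fun h3 h4 => ?_⟩⟩
    · rcases le_total a t with h | h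
      · exact h1 t h le_rfl
      · exact h2 t le_rfl h
    · rcases le_total a u with h | h
      · exact h1 u h h4
      · exact (ha u).1 h3 h
    · rcases le_total a u with h | h
      · exact (ha u).2 h h4
      · exact h2 u h3 h
  refine ⟨K, ⟨Finset.filter_subset _ _, irreducibleRoots_of_ordConnected ⟨p, hpK⟩ ?_, ?_⟩, ?_⟩
  · intro a ha b hb t hat htb
    have haJ := ((hK a).1 ha).2
    have hbJ := ((hK b).1 hb).2
    rcases le_total p t with h | h
    · exact hconn p hpK t (fun u h1 h2 => (hbJ u).1 h1 (h2.trans htb)) fun u h1 h2 =>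
        (hbJ u).1 (h.trans h1) ((h2.trans h).trans htb)
    · exact hconn p hpK t (fun u h1 h2 => (haJ u).2 (hat.trans (h.trans h1)) (h2.trans h))
        fun u h1 h2 => (haJ u).2 (hat.trans h1) h2
  · intro a ha b hb
    obtain ⟨k, hk, hkK⟩ : ∃ k, coef k b ≠ 0 ∧ k ∉ K := by
      by_contra! h
      exact hb.2 ⟨hb.1.1, mem_span_simples.2 fun i hi => by
        by_contra h'; exact hi (h i h')⟩
    have hb' : ∀ j, coef j b ≠ 0 → j ∉ K := fun j hj hjK =>
      hkK (hconn j hjK k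
        (fun u h1 h2 => mem_of_coef_ne_zero hb.1 (coef_ne_zero_of_between hb.1.1 h1 h2 hj hk))
        fun u h1 h2 => mem_of_coef_ne_zero hb.1 (coef_ne_zero_of_between hb.1.1 h1 h2 hk hj))
    refine dotProduct_eq_zero_of_coef fun i j hi hj => ?_
    have hiK := mem_of_coef_ne_zero ha hi
    have hjK := hb' j hj
    have hiJ := ((hK i).1 hiK).1
    have hjJ := mem_of_coef_ne_zero hb.1 hj
    by_contra hne
    have h1 : ¬ (i : ℕ) + 1 < j := fun h => hne (simpleRoot_dotProduct_eq_zero h)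
    have h2 : ¬ (j : ℕ) + 1 < i := fun h => hne (by
      rw [dotProduct_comm]; exact simpleRoot_dotProduct_eq_zero h)
    refine hjK (hconn i hiK j (fun u h3 h4 => ?_) fun u h3 h4 => ?_) <;>
    · rw [Fin.le_def] at h3 h4
      obtain h | h : (u : ℕ) = i ∨ (u : ℕ) = j := by omega
      · rwa [Fin.ext h]
      · rwa [Fin.ext h]
  · intro t h1 h2
    exact hconn p hpK t (fun u h3 h4 => h u h3 (h4.trans h2))
      fun u h3 h4 => h u (h1.trans h3) ((h4.trans hps))

-- Separability forces pattern avoidance.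

/-- A sequence of nonzero integers with distinct absolute values. -/
structure IsSignedWord {n : ℕ} (f : Fin n → ℤ) : Prop where
  ne_zero : ∀ i, f i ≠ 0
  ne : ∀ i j, i < j → f i ≠ f j
  add_ne : ∀ i j, i < j → f i + f j ≠ 0

theorem IsSignedWord.neg {n : ℕ} {f : Fin n → ℤ} (hf : IsSignedWord f) : IsSignedWord (-f) where
  ne_zero i := by simpa using hf.ne_zero i
  ne i j h := by simpa using hf.ne i j h
  add_ne i j h := by
    have := hf.add_ne i j h
    simp only [Pi.neg_apply]
    omega

theorem isSignedWord_oneLine {n : ℕ} (w : SignedPerm n) : IsSignedWord (oneLine w) where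
  ne_zero i := (w.1 (letter i)).2.1
  ne i j h := fun h' => h.ne (letter_injective (w.1.injective (Subtype.ext h')))
  add_ne i j h := fun h' => letter_ne_neg i j <| w.1.injective <| by
    rw [act_neg_apply]
    apply Subtype.ext
    simp only [oneLine, SignedIdx.neg] at h' ⊢
    omega

/-- The letters at positions `p < q < r < s` form neither the pattern `2413` nor `3142`. -/
def Avoids {ι : Type*} (f : ι → ℤ) (p q r s : ι) : Prop :=
  ¬ (f r < f p ∧ f p < f s ∧ f s < f q) ∧ ¬ (f q < f s ∧ f s < f p ∧ f p < f r)

theorem Avoids.neg {ι : Type*} {f : ι → ℤ} {p q r s : ι} (h : Avoids f p q r s) :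
    Avoids (-f) p q r s := by
  unfold Avoids at *
  simp only [Pi.neg_apply]
  omega

/-- If `x` and `y` have different signs, then `|x| ≤ |y|`. -/
def SignedLe (x y : ℤ) : Prop := ¬ (0 < x ∧ y < 0 ∧ 0 < x + y) ∧ ¬ (x < 0 ∧ 0 < y ∧ x + y < 0)

theorem SignedLe.neg {x y : ℤ} (h : SignedLe x y) : SignedLe (-x) (-y) := by
  unfold SignedLe at *
  omega

/-- Separability with respect to `Φ_J` as a pattern avoidance condition. -/
structure PatternSeparable {n : ℕ} (J : Finset (Fin n)) (f : Fin n → ℤ) : Prop where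
  -- The bound is strict at `p` because `-e p + e s` is the sum of the simple roots with indices in
  -- `(p, s]`.
  avoids : ∀ p q r s, p < q → q < r → r < s → (∀ t, p < t → t ≤ s → t ∈ J) → Avoids f p q r s
  signedLe : ∀ i j, i < j → (∀ t ≤ j, t ∈ J) → SignedLe (f i) (f j)

theorem PatternSeparable.neg {n : ℕ} {J : Finset (Fin n)} {f : Fin n → ℤ}
    (h : PatternSeparable J f) : PatternSeparable J (-f) where
  avoids p q r s hpq hqr hrs ht := (h.avoids p q r s hpq hqr hrs ht).neg
  signedLe i j hij ht := (h.signedLe i j hij ht).neg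

theorem PatternSeparable.mono {n : ℕ} {J K : Finset (Fin n)} {f : Fin n → ℤ}
    (h : PatternSeparable J f) (hKJ : K ⊆ J) : PatternSeparable K f where
  avoids p q r s hpq hqr hrs ht := h.avoids p q r s hpq hqr hrs fun t h1 h2 => hKJ (ht t h1 h2)
  signedLe i j hij ht := h.signedLe i j hij fun t h1 => hKJ (ht t h1)

/-- Only the signs taken on the roots of `Φ_K` matter, and these are what an inversion set records.
-/
theorem PatternSeparable.congr {n : ℕ} {K : Finset (Fin n)} {f g : Fin n → ℤ}
    (hf : IsSignedWord f) (hg : IsSignedWord g)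
    (h1 : ∀ j, (∀ t ≤ j, t ∈ K) → (f j < 0 ↔ g j < 0))
    (h2 : ∀ i j, i < j → (∀ t ≤ j, t ∈ K) → (f i + f j < 0 ↔ g i + g j < 0))
    (h3 : ∀ i j, i < j → (∀ t, i < t → t ≤ j → t ∈ K) → (f j < f i ↔ g j < g i))
    (h : PatternSeparable K f) : PatternSeparable K g where
  avoids p q r s hpq hqr hrs ht := by
    have hav := h.avoids p q r s hpq hqr hrs ht
    -- The chains of inequalities for 2413 and 3142 are both decided by comparing the pairs `(p,
    -- r)`, `(p, s)` and `(q, s)`.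
    have e1 := h3 p r (hpq.trans hqr) fun t a b => ht t a (b.trans hrs.le)
    have e2 := h3 p s (hpq.trans (hqr.trans hrs)) ht
    have e3 := h3 q s (hqr.trans hrs) fun t a b => ht t (hpq.trans a) b
    have n1 := hf.ne p r (hpq.trans hqr)
    have n2 := hf.ne p s (hpq.trans (hqr.trans hrs))
    have n3 := hf.ne q s (hqr.trans hrs)
    have m1 := hg.ne p r (hpq.trans hqr)
    have m2 := hg.ne p s (hpq.trans (hqr.trans hrs))
    have m3 := hg.ne q s (hqr.trans hrs)
    unfold Avoids at *
    omega
  signedLe i j hij ht := by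
    have hle := h.signedLe i j hij ht
    have e1 := h1 i fun t a => ht t (a.trans hij.le)
    have e2 := h1 j ht
    have e3 := h2 i j hij ht
    have n1 := hf.ne_zero i
    have n2 := hf.ne_zero j
    have n3 := hf.add_ne i j hij
    have m1 := hg.ne_zero i
    have m2 := hg.ne_zero j
    have m3 := hg.add_ne i j hij
    unfold SignedLe at *
    omega

/-- This lets every recursive call be expressed through the original word `w`, although the
definition changes the group element at each restriction. -/
theorem IsRestriction.patternSeparable_iff {n : ℕ} {J K : Finset (Fin n)} {w v : SignedPerm n}
    (hw : Stabilizes J w) (hKJ : K ⊆ J) (h : IsRestriction J w K v) :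
    PatternSeparable K (oneLine v) ↔ PatternSeparable K (oneLine w) := by
  have hv := stabilizes_of_mem_parabolic h.1
  have key : ∀ β ∈ posSubroots K, (β ∈ inversions K v ↔ β ∈ inversions J w) := by
    intro β hβ
    rw [← h.2]
    exact and_iff_left hβ.2
  have h1 : ∀ j, (∀ t ≤ j, t ∈ K) → (oneLine v j < 0 ↔ oneLine w j < 0) := fun j ht => by
    rw [← e_mem_inversions hv ht, ← e_mem_inversions hw fun t h' => hKJ (ht t h')]
    exact key _ (e_mem_posSubroots ht)
  have h2 : ∀ i j, i < j → (∀ t ≤ j, t ∈ K) →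
      (oneLine v i + oneLine v j < 0 ↔ oneLine w i + oneLine w j < 0) := fun i j hij ht => by
    rw [← e_add_e_mem_inversions hv hij ht,
      ← e_add_e_mem_inversions hw hij fun t h' => hKJ (ht t h')]
    exact key _ (e_add_e_mem_posSubroots hij ht)
  have h3 : ∀ i j, i < j → (∀ t, i < t → t ≤ j → t ∈ K) →
      (oneLine v j < oneLine v i ↔ oneLine w j < oneLine w i) := fun i j hij ht => by
    rw [← neg_e_add_e_mem_inversions hv hij ht,
      ← neg_e_add_e_mem_inversions hw hij fun t h' h'' => hKJ (ht t h' h'')]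
    exact key _ (neg_e_add_e_mem_posSubroots hij ht)
  exact ⟨.congr (isSignedWord_oneLine v) (isSignedWord_oneLine w) h1 h2 h3,
    .congr (isSignedWord_oneLine w) (isSignedWord_oneLine v) (fun j h => (h1 j h).symm)
      (fun i j h h' => (h2 i j h h').symm) fun i j h h' => (h3 i j h h').symm⟩

/-- The pivot condition in one-line notation, for a property `Q` such as being negative. -/
theorem pivot_iff {n : ℕ} {J : Finset (Fin n)} {w : SignedPerm n} {i : Fin n} (hi : i ∈ J)
    (Q : ℝ → Prop) :
    (∀ β ∈ posSubroots J, AboveSimple J i β → Q (ht (act w β))) ↔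
      (∀ j, i ≤ j → (∀ t ≤ j, t ∈ J) → Q (oneLine w j)) ∧
      (∀ a b, a < b → i ≤ b → (∀ t ≤ b, t ∈ J) → Q (oneLine w a + oneLine w b)) ∧
      (∀ a b, a < i → i ≤ b → (∀ t, a < t → t ≤ b → t ∈ J) →
        Q (oneLine w b - oneLine w a)) := by
  constructor
  · intro h
    refine ⟨fun j hij ht => ?_, fun a b hab hib ht => ?_, fun a b hai hib ht => ?_⟩
    · have hm := e_mem_posSubroots ht
      have := h _ hm ((aboveSimple_iff hm hi).2 (by rw [coef_e, if_pos hij]; norm_num))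
      rwa [ht_act_e] at this
    · have hm := e_add_e_mem_posSubroots hab ht
      have := h _ hm ((aboveSimple_iff hm hi).2 (by
        rw [map_add, coef_e, coef_e, if_pos hib]; split_ifs <;> norm_num))
      rwa [act_add, map_add, ht_act_e, ht_act_e] at this
    · have hm := neg_e_add_e_mem_posSubroots (hai.trans_le hib) ht
      have := h _ hm ((aboveSimple_iff hm hi).2 (by
        rw [map_add, map_neg, coef_e, coef_e, if_pos hib, if_neg hai.not_ge]; norm_num))
      rwa [act_add, act_neg, map_add, map_neg, ht_act_e, ht_act_e, neg_add_eq_sub] at this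
  · rintro ⟨h1, h2, h3⟩ β hβ ha
    rw [aboveSimple_iff hβ hi] at ha
    rcases mem_posSubroots_cases hβ with ⟨j, ht, rfl⟩ | ⟨a, b, hab, ht, rfl⟩ | ⟨a, b, hab, ht, rfl⟩
    · rw [ht_act_e]
      refine h1 j ?_ ht
      by_contra h
      simp [coef_e, h] at ha
    · rw [act_add, map_add, ht_act_e, ht_act_e]
      refine h2 a b hab ?_ ht
      by_contra h
      have h' : ¬ i ≤ a := fun h' => h (h'.trans hab.le)
      simp [coef_e, h, h'] at ha
    · rw [act_add, act_neg, map_add, map_neg, ht_act_e, ht_act_e, neg_add_eq_sub]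
      rw [map_add, map_neg, coef_e, coef_e] at ha
      refine h3 a b ?_ ?_ ht
      · by_contra h
        rw [if_pos (not_lt.1 h)] at ha
        split_ifs at ha <;> norm_num at ha
      · by_contra h
        rw [if_neg h] at ha
        split_ifs at ha <;> norm_num at ha

/-- A sign-definite pivot reduces pattern separability to the parabolic omitting it. -/
theorem PatternSeparable.of_erase {n : ℕ} {J : Finset (Fin n)} {f : Fin n → ℤ} {i : Fin n}
    (h : PatternSeparable (J.erase i) f)
    (h1 : ∀ j, i ≤ j → (∀ t ≤ j, t ∈ J) → f j < 0)
    (h2 : ∀ a b, a < b → i ≤ b → (∀ t ≤ b, t ∈ J) → f a + f b < 0)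
    (h3 : ∀ a b, a < i → i ≤ b → (∀ t, a < t → t ≤ b → t ∈ J) → f b - f a < 0) :
    PatternSeparable J f where
  avoids p q r s hpq hqr hrs ht := by
    -- Every letter before the cut exceeds every letter from the cut on, while neither 2413 nor 3142
    -- splits into a higher initial block and a lower final one.
    by_cases hi : p < i ∧ i ≤ s
    · have h4 := h3 p s hi.1 hi.2 ht
      unfold Avoids
      rcases lt_or_ge q i with h | h
      · have h5 := h3 q s h hi.2 fun t a b => ht t (hpq.trans a) b
        rcases lt_or_ge r i with h' | h'
        · have h6 := h3 r s h' hi.2 fun t a b => ht t (hpq.trans (hqr.trans a)) b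
          omega
        · have h6 := h3 p r hi.1 h' fun t a b => ht t a (b.trans hrs.le)
          omega
      · have h5 := h3 p q hi.1 h fun t a b => ht t a (b.trans (hqr.trans hrs).le)
        have h6 := h3 p r hi.1 (h.trans hqr.le) fun t a b => ht t a (b.trans hrs.le)
        omega
    · refine h.avoids p q r s hpq hqr hrs fun t a b => Finset.mem_erase.2 ⟨?_, ht t a b⟩
      rintro rfl
      exact hi ⟨a, b⟩
  signedLe a b hab ht := by
    by_cases hi : i ≤ b
    · have h4 := h1 b hi ht
      have h5 := h2 a b hab hi ht
      unfold SignedLe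
      omega
    · refine h.signedLe a b hab fun t h' => Finset.mem_erase.2 ⟨?_, ht t h'⟩
      rintro rfl
      exact hi h'

/-- Each forbidden configuration lives on an interval of simple indices. In a reducible `Φ_J` that
interval lies in a single component; in an irreducible one the sign-definite pivot excludes
configurations that meet it. -/
theorem SeparableIn.patternSeparable {n : ℕ} {J : Finset (Fin n)} {w : SignedPerm n}
    (h : SeparableIn J w) (hw : Stabilizes J w) : PatternSeparable J (oneLine w) := by
  induction h with
  | typeA1 i w =>
    constructor
    · intro p q r s hpq hqr hrs ht
      have h1 := ht q hpq (hqr.trans hrs).le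
      have h2 := ht r (hpq.trans hqr) hrs.le
      rw [Finset.mem_singleton] at h1 h2
      exact absurd (h1.trans h2.symm) hqr.ne
    · intro a b hab ht
      have h1 := ht a hab.le
      have h2 := ht b le_rfl
      rw [Finset.mem_singleton] at h1 h2
      exact absurd (h1.trans h2.symm) hab.ne
  | reducible J w hJ v hv hsep ih =>
    have key : ∀ K, IsComponent J K → PatternSeparable K (oneLine w) := fun K hK =>
      ((hv K hK).patternSeparable_iff hw hK.1).1
        (ih K hK (stabilizes_of_mem_parabolic (hv K hK).1))
    constructor
    · intro p q r s hpq hqr hrs ht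
      -- The half-open window `(p, s]` becomes the closed interval `[p + 1, s]`.
      let p' : Fin n := ⟨(p : ℕ) + 1, by have := Fin.lt_def.1 hpq; omega⟩
      have hp' : ∀ t, p < t ↔ p' ≤ t := fun t => by
        simp only [p', Fin.lt_def, Fin.le_def]; omega
      obtain ⟨K, hK, hsub⟩ := exists_isComponent ((hp' s).1 (hpq.trans (hqr.trans hrs)))
        fun t h1 h2 => ht t ((hp' t).2 h1) h2
      exact (key K hK).avoids p q r s hpq hqr hrs fun t h1 h2 => hsub t ((hp' t).1 h1) h2
    · intro a b hab ht
      have hz : ∀ t : Fin n, (⟨0, by omega⟩ : Fin n) ≤ t := fun t => Fin.le_def.2 (Nat.zero_le _)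
      obtain ⟨K, hK, hsub⟩ := exists_isComponent (hz b) fun t _ h2 => ht t h2
      exact (key K hK).signedLe a b hab fun t h2 => hsub t (hz t) h2
  | pivot J w hJ i hi v hv hsep hpivot ih =>
    have hK := (hv.patternSeparable_iff hw (Finset.erase_subset _ _)).1
      (ih (stabilizes_of_mem_parabolic hv.1))
    rcases hpivot with h | h
    · obtain ⟨h1, h2, h3⟩ := (pivot_iff (w := w) hi (· < 0)).1 fun β hβ ha =>
        ((mem_inversions hw).1 (h β hβ ha)).2
      refine hK.of_erase (fun j a b => ?_) (fun a b c d f => ?_) (fun a b c d f => ?_)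
      · exact_mod_cast h1 j a b
      · exact_mod_cast h2 a b c d f
      · exact_mod_cast h3 a b c d f
    · obtain ⟨h1, h2, h3⟩ := (pivot_iff (w := w) hi (0 < ·)).1 fun β hβ ha =>
        lt_of_le_of_ne (not_lt.1 fun h' => h β hβ ha ((mem_inversions hw).2 ⟨hβ, h'⟩))
          (ht_ne_zero (act_mem_roots w (Or.inl hβ.1))).symm
      have := hK.neg.of_erase (fun j a b => ?_) (fun a b c d f => ?_) (fun a b c d f => ?_)
      · simpa using this.neg
      · have : 0 < oneLine w j := by exact_mod_cast h1 j a b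
        simpa using this
      · have : 0 < oneLine w a + oneLine w b := by exact_mod_cast h2 a b c d f
        simp only [Pi.neg_apply]; omega
      · have : 0 < oneLine w b - oneLine w a := by exact_mod_cast h3 a b c d f
        simp only [Pi.neg_apply]; omega

-- Pattern avoidance produces pivots.

/-- The positions `[a, b]` split at `i` into a lower left and an upper right part. -/
def SumCut (f : ℕ → ℤ) (a i b : ℕ) : Prop := ∀ p q, a ≤ p → p < i → i ≤ q → q ≤ b → f p < f q

/-- The inductive step for appending one letter to a direct sum. The new letter is above the first
summand and the cut survives, or it is below everything and is split off, or it completes a 3142. -/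
theorem exists_cut_of_sumCut {f : ℕ → ℤ} {a m : ℕ}
    (hinj : ∀ p q, a ≤ p → p < q → q ≤ m + 1 → f p ≠ f q)
    (hav : ∀ p q r s, a ≤ p → p < q → q < r → r < s → s ≤ m + 1 → Avoids f p q r s)
    (ih : ∀ b, a < b → b ≤ m → ∃ i, a < i ∧ i ≤ b ∧ (SumCut f a i b ∨ SumCut (-f) a i b))
    (hcut : ∃ i, a < i ∧ i ≤ m ∧ SumCut f a i m) :
    ∃ i, a < i ∧ i ≤ m + 1 ∧ (SumCut f a i (m + 1) ∨ SumCut (-f) a i (m + 1)) := by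
  classical
  -- The least cut makes the first summand sum-indecomposable, so its own cut `k` below must be
  -- skew.
  obtain ⟨hai, him, hi⟩ := Nat.find_spec hcut
  have hmin := fun j (hj : j < Nat.find hcut) => Nat.find_min hcut hj
  generalize Nat.find hcut = i at hai him hi hmin
  by_cases hz : ∀ p, a ≤ p → p < i → f p < f (m + 1)
  · refine ⟨i, hai, by omega, Or.inl fun p q h1 h2 h3 h4 => ?_⟩
    rcases Nat.lt_or_ge m q with h | h
    · rw [show q = m + 1 by omega]; exact hz p h1 h2
    · exact hi p q h1 h2 h3 h
  by_cases hz' : ∀ p, a ≤ p → p ≤ m → f (m + 1) < f p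
  · refine ⟨m + 1, by omega, le_rfl, Or.inr fun p q h1 h2 h3 h4 => ?_⟩
    rw [show q = m + 1 by omega]
    simpa using hz' p h1 (by omega)
  exfalso
  push Not at hz hz'
  obtain ⟨u, hau, hui, hu⟩ := hz
  obtain ⟨v, hav', hvm, hv⟩ := hz'
  have hu' := lt_of_le_of_ne hu (hinj u (m + 1) hau (by omega) le_rfl).symm
  have hv' := lt_of_le_of_ne hv (hinj v (m + 1) hav' (by omega) le_rfl)
  have hvi : v < i := by
    by_contra h
    have := hi u v hau hui (by omega) hvm
    omega
  have huv : u ≠ v := by rintro rfl; omega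
  obtain ⟨k, hak, hki, hk | hk⟩ := ih (i - 1) (by omega) (by omega)
  · refine hmin k (by omega) ⟨hak, by omega, fun p q h1 h2 h3 h4 => ?_⟩
    rcases Nat.lt_or_ge q i with h | h
    · exact hk p q h1 h2 h3 (by omega)
    · exact hi p q h1 (by omega) h h4
  · have skew : ∀ p q, a ≤ p → p < k → k ≤ q → q ≤ i - 1 → f q < f p := fun p q h1 h2 h3 h4 => by
      simpa using hk p q h1 h2 h3 h4
    -- The positions `p`, `q`, `m`, `m + 1` would carry a 3142, the letter at `m` being above the
    -- first summand.
    have key : ∀ p q, a ≤ p → p < k → k ≤ q → q ≤ i - 1 →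
        ¬ (f q < f (m + 1) ∧ f (m + 1) < f p) := fun p q h1 h2 h3 h4 h5 =>
      (hav p q m (m + 1) h1 (by omega) (by omega) (by omega) le_rfl).2
        ⟨h5.1, h5.2, hi p m h1 (by omega) (by omega) le_rfl⟩
    have hka := skew a k le_rfl hak le_rfl hki
    rcases Nat.lt_or_ge u k with h | h
    · have h1 := key u k hau h le_rfl hki
      rcases Nat.lt_or_ge v k with h' | h'
      · have h2 := skew v k hav' h' le_rfl hki
        omega
      · have h2 := key u v hau h h' (by omega)
        omega
    · have h1 := skew a u le_rfl hak h (by omega)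
      rcases Nat.lt_or_ge v k with h' | h'
      · have h2 := skew v u hav' h' h (by omega)
        omega
      · have h2 := key a v le_rfl hak h' (by omega)
        omega

/-- A separable sequence of length at least two is a direct sum or a skew sum. -/
theorem exists_cut {f : ℕ → ℤ} {a b : ℕ} (hab : a < b)
    (hinj : ∀ p q, a ≤ p → p < q → q ≤ b → f p ≠ f q)
    (hav : ∀ p q r s, a ≤ p → p < q → q < r → r < s → s ≤ b → Avoids f p q r s) :
    ∃ i, a < i ∧ i ≤ b ∧ (SumCut f a i b ∨ SumCut (-f) a i b) := by
  induction b using Nat.strong_induction_on with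
  | _ b ih =>
    obtain ⟨m, rfl⟩ : ∃ m, b = m + 1 := ⟨b - 1, by omega⟩
    have ih' : ∀ b, a < b → b ≤ m → ∃ i, a < i ∧ i ≤ b ∧ (SumCut f a i b ∨ SumCut (-f) a i b) :=
      fun b h1 h2 => ih b (by omega) h1 (fun p q h3 h4 h5 => hinj p q h3 h4 (by omega))
        fun p q r s h3 h4 h5 h6 h7 => hav p q r s h3 h4 h5 h6 (by omega)
    rcases Nat.lt_or_ge a m with h | h
    · obtain ⟨i, h1, h2, h3 | h3⟩ := ih' m h le_rfl
      · exact exists_cut_of_sumCut hinj hav ih' ⟨i, h1, h2, h3⟩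
      · obtain ⟨j, h4, h5, h6⟩ := exists_cut_of_sumCut (f := -f)
          (fun p q h4 h5 h6 => by simpa using hinj p q h4 h5 h6)
          (fun p q r s h4 h5 h6 h7 h8 => (hav p q r s h4 h5 h6 h7 h8).neg)
          (fun b h4 h5 => by simpa [or_comm] using ih' b h4 h5) ⟨i, h1, h2, h3⟩
        exact ⟨j, h4, h5, by simpa [or_comm] using h6⟩
    · obtain rfl : a = m := by omega
      refine ⟨a + 1, by omega, le_rfl, ?_⟩
      rcases lt_or_gt_of_ne (hinj a (a + 1) le_rfl (by omega) le_rfl) with h' | h'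
      · left
        intro p q h1 h2 h3 h4
        rwa [show p = a by omega, show q = a + 1 by omega]
      · right
        intro p q h1 h2 h3 h4
        rw [show p = a by omega, show q = a + 1 by omega]
        simpa using h'

/-- The positions from `i` to `m` carry positive letters that exceed all the absolute values
occurring before `i`. -/
theorem exists_positive_block {n : ℕ} {f : Fin n → ℤ} (hf : IsSignedWord f) {m : Fin n}
    (hle : ∀ i j, i < j → j ≤ m → SignedLe (f i) (f j)) (hm : 0 < f m) :
    ∃ i ≤ m, (∀ j, i ≤ j → j ≤ m → 0 < f j) ∧
      ∀ a b, a < i → i ≤ b → b ≤ m → 0 < f a + f b ∧ 0 < f b - f a := by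
  classical
  have hex : ∃ k : ℕ, k < n ∧ ∀ j : Fin n, k ≤ j → j ≤ m → 0 < f j :=
    ⟨m, m.2, fun j h1 h2 => by rwa [show j = m from le_antisymm h2 h1]⟩
  obtain ⟨k, ⟨hlt, hpos⟩, hmin, hkm⟩ : ∃ k : ℕ, (k < n ∧ ∀ j : Fin n, k ≤ j → j ≤ m → 0 < f j) ∧
      (∀ l < k, ¬ (l < n ∧ ∀ j : Fin n, l ≤ j → j ≤ m → 0 < f j)) ∧ k ≤ m :=
    ⟨Nat.find hex, Nat.find_spec hex, fun l hl => Nat.find_min hex hl,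
      Nat.find_min' hex ⟨m.2, fun j h1 h2 => by rwa [show j = m from le_antisymm h2 h1]⟩⟩
  refine ⟨⟨k, hlt⟩, hkm, fun j h1 h2 => hpos j h1 h2, fun a b ha hb hbm => ?_⟩
  have hak : (a : ℕ) < k := ha
  have hkb : k ≤ b := hb
  -- By minimality of `k` the letter just before the block is negative. It dominates the earlier
  -- positive letters in absolute value and is itself dominated by the block.
  let c : Fin n := ⟨k - 1, by omega⟩
  have hc : f c < 0 := by
    refine lt_of_le_of_ne (not_lt.1 fun h => ?_) (hf.ne_zero c)
    refine hmin (k - 1) (by omega) ⟨by omega, fun j h1 h2 => ?_⟩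
    rcases Nat.lt_or_ge j k with h' | h'
    · rwa [show j = c from Fin.ext (by simp only [c]; omega)]
    · exact hpos j h' h2
  have hb' := hpos b hb hbm
  have hcb : c < b := Fin.lt_def.2 (by simp only [c]; omega)
  have h1 := hle c b hcb hbm
  have n1 := hf.add_ne c b hcb
  have h2 := hle a b (ha.trans_le hb) hbm
  have n2 := hf.add_ne a b (ha.trans_le hb)
  have n3 := hf.ne_zero a
  unfold SignedLe at h1 h2
  rcases Nat.lt_or_ge a (k - 1) with h' | h'
  · have h3 := hle a c h' (Fin.le_def.2 (by rw [Fin.le_def] at hbm; simp only [c]; omega))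
    have n4 := hf.add_ne a c h'
    unfold SignedLe at h3
    omega
  · have hac : f a = f c := congrArg f (Fin.ext (by simp only [c]; omega))
    omega

/-- Taking `g = f` means no root above the pivot is inverted, and `g = -f` means all are. If `J`
contains the index of `α_0`, the sign of the last letter selects `g` and the pivot starts the final
run of that sign. Otherwise only differences occur, and a direct or skew cut is a pivot. -/
theorem exists_pivot {n : ℕ} {J : Finset (Fin n)} {f : Fin n → ℤ} (hf : IsSignedWord f)
    (hne : J.Nonempty) (hJ : ∀ a ∈ J, ∀ b ∈ J, ∀ t, a ≤ t → t ≤ b → t ∈ J)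
    (hsep : PatternSeparable J f) :
    ∃ i ∈ J, ∃ g, (g = f ∨ g = -f) ∧
      (∀ j, i ≤ j → (∀ t ≤ j, t ∈ J) → 0 < g j) ∧
      (∀ a b, a < b → i ≤ b → (∀ t ≤ b, t ∈ J) → 0 < g a + g b) ∧
      (∀ a b, a < i → i ≤ b → (∀ t, a < t → t ≤ b → t ∈ J) → 0 < g b - g a) := by
  obtain ⟨m, hmaxJ, hmax⟩ : ∃ m ∈ J, ∀ t ∈ J, t ≤ m :=
    ⟨_, J.max'_mem hne, fun t ht => J.le_max' t ht⟩
  obtain ⟨l, hminJ, hmin⟩ : ∃ l ∈ J, ∀ t ∈ J, l ≤ t :=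
    ⟨_, J.min'_mem hne, fun t ht => J.min'_le t ht⟩
  have hlm := hmin m hmaxJ
  by_cases hl : (l : ℕ) = 0
  · have hmem : ∀ t ≤ m, t ∈ J := fun t ht =>
      hJ l hminJ m hmaxJ t (Fin.le_def.2 (by omega)) ht
    have key : ∀ g, IsSignedWord g → PatternSeparable J g → 0 < g m → ∃ i ∈ J,
        (∀ j, i ≤ j → (∀ t ≤ j, t ∈ J) → 0 < g j) ∧
        (∀ a b, a < b → i ≤ b → (∀ t ≤ b, t ∈ J) → 0 < g a + g b) ∧
        (∀ a b, a < i → i ≤ b → (∀ t, a < t → t ≤ b → t ∈ J) → 0 < g b - g a) := by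
      intro g hg hgs hgm
      obtain ⟨i, him, h1, h2⟩ := exists_positive_block hg (fun i j hij hjm =>
        hgs.signedLe i j hij fun t ht => hmem t (ht.trans hjm)) hgm
      refine ⟨i, hmem i him, fun j hij ht => h1 j hij (hmax _ (ht j le_rfl)),
        fun a b hab hib ht => ?_, fun a b hai hib ht =>
          (h2 a b hai hib (hmax _ (ht b (hai.trans_le hib) le_rfl))).2⟩
      have hbm := hmax _ (ht b le_rfl)
      rcases lt_or_ge a i with h | h
      · exact (h2 a b h hib hbm).1
      · have := h1 a h (hab.le.trans hbm)
        have := h1 b hib hbm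
        omega
    rcases lt_or_gt_of_ne (hf.ne_zero m) with h | h
    · obtain ⟨i, hi, h'⟩ := key (-f) hf.neg hsep.neg (by simpa using h)
      exact ⟨i, hi, -f, Or.inr rfl, h'⟩
    · obtain ⟨i, hi, h'⟩ := key f hf hsep h
      exact ⟨i, hi, f, Or.inl rfl, h'⟩
  · have hzero : ∀ j, ¬ ∀ t ≤ j, t ∈ J := fun j h => by
      have := hmin _ (h ⟨0, by omega⟩ (Fin.le_def.2 (Nat.zero_le _)))
      rw [Fin.le_def] at this
      exact hl (by simpa using this)
    have hmem : ∀ t, l ≤ t → t ≤ m → t ∈ J := fun t h1 h2 => hJ l hminJ m hmaxJ t h1 h2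
    rw [Fin.le_def] at hlm
    let F : ℕ → ℤ := fun k => if h : k < n then f ⟨k, h⟩ else 0
    have hF : ∀ k (h : k < n), F k = f ⟨k, h⟩ := fun k h => dif_pos h
    -- The indices `[l, m]` govern the positions `[l - 1, m]`; the default value of `F` is never
    -- read there.
    obtain ⟨i, hli, him, hi⟩ := exists_cut (f := F) (a := (l : ℕ) - 1) (b := m) (by omega)
      (fun p q h1 h2 h3 => by
        rw [hF p (by omega), hF q (by omega)]
        exact hf.ne _ _ (Fin.lt_def.2 h2))
      (fun p q r s h1 h2 h3 h4 h5 => by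
        have := hsep.avoids ⟨p, by omega⟩ ⟨q, by omega⟩ ⟨r, by omega⟩ ⟨s, by omega⟩
          (Fin.lt_def.2 h2) (Fin.lt_def.2 h3) (Fin.lt_def.2 h4) fun t h6 h7 => hmem t
            (by rw [Fin.lt_def] at h6; rw [Fin.le_def]; simp only at h6; omega)
            (h7.trans (Fin.le_def.2 h5))
        unfold Avoids at *
        rwa [hF p (by omega), hF q (by omega), hF r (by omega), hF s (by omega)])
    have hin : i < n := by omega
    have bounds : ∀ a b : Fin n, a < (⟨i, hin⟩ : Fin n) → (⟨i, hin⟩ : Fin n) ≤ b →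
        (∀ t, a < t → t ≤ b → t ∈ J) → (l : ℕ) - 1 ≤ a ∧ (a : ℕ) < i ∧ i ≤ b ∧ (b : ℕ) ≤ m := by
      intro a b h1 h2 ht
      have h3 : (a : ℕ) < i := h1
      have h4 : i ≤ b := h2
      have h5 := hmin _ (ht ⟨(a : ℕ) + 1, by omega⟩ (Fin.lt_def.2 (by simp))
        (Fin.le_def.2 (by simp only; omega)))
      have h6 := hmax _ (ht b (h1.trans_le h2) le_rfl)
      rw [Fin.le_def] at h5 h6
      simp only at h5
      omega
    refine ⟨⟨i, hin⟩, hmem _ (Fin.le_def.2 (by simp only; omega)) (Fin.le_def.2 him), ?_⟩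
    rcases hi with hi | hi
    · refine ⟨f, Or.inl rfl, fun j _ h => absurd h (hzero j), fun _ b _ _ h => absurd h (hzero b),
        fun a b h1 h2 ht => ?_⟩
      obtain ⟨h3, h4, h5, h6⟩ := bounds a b h1 h2 ht
      have := hi a b h3 h4 h5 h6
      rw [hF a a.2, hF b b.2] at this
      simpa using this
    · refine ⟨-f, Or.inr rfl, fun j _ h => absurd h (hzero j), fun _ b _ _ h => absurd h (hzero b),
        fun a b h1 h2 ht => ?_⟩
      obtain ⟨h3, h4, h5, h6⟩ := bounds a b h1 h2 ht
      have := hi a b h3 h4 h5 h6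
      simp only [Pi.neg_apply] at this ⊢
      rw [hF a a.2, hF b b.2] at this
      simp only [Fin.eta] at this
      omega

/-- Induction on `J`: a pivot removes one simple root, and in the reducible case each component is a
proper subset because `Φ_J` itself is not irreducible. -/
theorem separableIn_of_patternSeparable {n : ℕ} {J : Finset (Fin n)} {w : SignedPerm n}
    (hw : Stabilizes J w) (h : PatternSeparable J (oneLine w)) : SeparableIn J w := by
  classical
  induction J using Finset.strongInduction generalizing w with
  | H J ih =>
    by_cases hJ : IrreducibleRoots (subroots J)
    · obtain ⟨hne, hconn⟩ := ordConnected_of_irreducibleRoots hJ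
      obtain ⟨i, hi, g, hg, h1, h2, h3⟩ :=
        exists_pivot (isSignedWord_oneLine w) hne hconn h
      obtain ⟨v, hv⟩ := exists_isRestriction hw (J.erase_subset i)
      refine .pivot J w hJ i hi v hv (ih _ (Finset.erase_ssubset hi)
        (stabilizes_of_mem_parabolic hv.1) ((hv.patternSeparable_iff hw
          (J.erase_subset i)).2 (h.mono (J.erase_subset i)))) ?_
      rcases hg with rfl | rfl
      · right
        have := (pivot_iff (w := w) hi (0 < ·)).2 ⟨fun j a b => by exact_mod_cast h1 j a b,
          fun a b c d f => by exact_mod_cast h2 a b c d f,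
          fun a b c d f => by exact_mod_cast h3 a b c d f⟩
        exact fun β hβ ha hinv => (((mem_inversions hw).1 hinv).2.trans (this β hβ ha)).false
      · left
        have := (pivot_iff (w := w) hi (· < 0)).2 ⟨fun j a b => by
            have := h1 j a b
            simp only [Pi.neg_apply] at this
            exact_mod_cast (by omega : oneLine w j < 0),
          fun a b c d f => by
            have := h2 a b c d f
            simp only [Pi.neg_apply] at this
            exact_mod_cast (by omega : oneLine w a + oneLine w b < 0),
          fun a b c d f => by
            have := h3 a b c d f
            simp only [Pi.neg_apply] at this
            exact_mod_cast (by omega : oneLine w b - oneLine w a < 0)⟩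
        exact fun β hβ ha => (mem_inversions hw).2 ⟨hβ, this β hβ ha⟩
    · have hv : ∀ K, ∃ v, IsComponent J K → IsRestriction J w K v := fun K => by
        by_cases hK : IsComponent J K
        · obtain ⟨v, hv⟩ := exists_isRestriction hw hK.1
          exact ⟨v, fun _ => hv⟩
        · exact ⟨1, fun h => absurd h hK⟩
      choose v hv using hv
      refine .reducible J w hJ v hv fun K hK => ih K ?_ (stabilizes_of_mem_parabolic (hv K hK).1)
        (((hv K hK).patternSeparable_iff hw hK.1).2 (h.mono hK.1))
      refine Finset.ssubset_iff_subset_ne.2 ⟨hK.1, ?_⟩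
      rintro rfl
      exact hJ hK.2.1

-- Minimal non-separability in terms of the word.

theorem separable_iff {n : ℕ} {w : SignedPerm n} :
    Separable w ↔ PatternSeparable Finset.univ (oneLine w) :=
  ⟨fun h => SeparableIn.patternSeparable h (stabilizes_univ w),
    separableIn_of_patternSeparable (stabilizes_univ w)⟩

theorem exists_restriction_separableIn_iff {n : ℕ} {w : SignedPerm n} {J : Finset (Fin n)} :
    (∃ v, IsRestriction Finset.univ w J v ∧ SeparableIn J v) ↔
      PatternSeparable J (oneLine w) := by
  constructor
  · rintro ⟨v, hv, hs⟩
    exact (hv.patternSeparable_iff (stabilizes_univ w) (Finset.subset_univ _)).1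
      (hs.patternSeparable (stabilizes_of_mem_parabolic hv.1))
  · intro h
    obtain ⟨v, hv⟩ := exists_isRestriction (stabilizes_univ w) (Finset.subset_univ J)
    exact ⟨v, hv, separableIn_of_patternSeparable (stabilizes_of_mem_parabolic hv.1)
      ((hv.patternSeparable_iff (stabilizes_univ w) (Finset.subset_univ _)).2 h)⟩

theorem patternSeparable_univ {n : ℕ} {f : Fin n → ℤ} :
    PatternSeparable Finset.univ f ↔
      (∀ p q r s, p < q → q < r → r < s → Avoids f p q r s) ∧
        ∀ i j, i < j → SignedLe (f i) (f j) :=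
  ⟨fun h => ⟨fun p q r s h1 h2 h3 => h.avoids p q r s h1 h2 h3 fun _ _ _ => Finset.mem_univ _,
    fun i j hij => h.signedLe i j hij fun _ _ => Finset.mem_univ _⟩,
    fun h => ⟨fun p q r s h1 h2 h3 _ => h.1 p q r s h1 h2 h3, fun i j hij _ => h.2 i j hij⟩⟩

/-- Two maximal proper subsets decide. Omitting `α_0` keeps all differences of positions and forces
avoidance; omitting the last simple root keeps the sign condition before the last position. The sign
condition at the last position needs all of `Δ`, so no proper `J` tests it. -/
theorem minimalNonseparable_iff {n : ℕ} {w : SignedPerm (n + 1)} :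
    MinimalNonseparable w ↔
      (∀ p q r s, p < q → q < r → r < s → Avoids (oneLine w) p q r s) ∧
        (∀ i j, i < j → j < Fin.last n → SignedLe (oneLine w i) (oneLine w j)) ∧
        ∃ i j, i < j ∧ ¬ SignedLe (oneLine w i) (oneLine w j) := by
  unfold MinimalNonseparable
  simp only [exists_restriction_separableIn_iff, separable_iff]
  constructor
  · rintro ⟨h1, h2⟩
    have hA : ∀ p q r s, p < q → q < r → r < s → Avoids (oneLine w) p q r s := by
      refine fun p q r s hpq hqr hrs => (h2 (Finset.univ.erase 0)
        (Finset.erase_ssubset (Finset.mem_univ _))).avoids p q r s hpq hqr hrs fun t h _ =>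
          Finset.mem_erase.2 ⟨?_, Finset.mem_univ _⟩
      rintro rfl
      exact absurd h (Fin.not_lt_zero p)
    refine ⟨hA, fun i j hij hj => ?_, ?_⟩
    · refine (h2 (Finset.univ.erase (Fin.last n))
        (Finset.erase_ssubset (Finset.mem_univ _))).signedLe i j hij fun t h =>
          Finset.mem_erase.2 ⟨(h.trans_lt hj).ne, Finset.mem_univ _⟩
    · by_contra! h
      exact h1 (patternSeparable_univ.2 ⟨hA, h⟩)
  · rintro ⟨hA, hB, i, j, hij, h⟩
    refine ⟨fun hs => h ((patternSeparable_univ.1 hs).2 i j hij), fun J hJ =>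
      ⟨fun p q r s h1 h2 h3 _ => hA p q r s h1 h2 h3, fun a b hab ht => hB a b hab ?_⟩⟩
    refine lt_of_le_of_ne (Fin.le_last b) ?_
    rintro rfl
    exact hJ.2 fun t _ => ht t (Fin.le_last t)

theorem natAbs_oneLine_le {n : ℕ} (w : SignedPerm n) (i : Fin n) : (oneLine w i).natAbs ≤ n := by
  have := (w.1 (letter i)).2.2
  rw [Int.abs_eq_natAbs] at this
  exact_mod_cast this

-- Inverses and realization of signed words.

/-- Passing to the inverse: the letter `±k` at position `i` becomes `±i` at position `k`. -/
def InverseAt {n : ℕ} (w : SignedPerm n) (i k : Fin n) : Prop :=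
  (oneLine w i = k + 1 ∧ oneLine w⁻¹ k = i + 1) ∨
    (oneLine w i = -(k + 1) ∧ oneLine w⁻¹ k = -(i + 1))

theorem InverseAt.inv {n : ℕ} {w : SignedPerm n} {i k : Fin n} (h : InverseAt w i k) :
    InverseAt w⁻¹ k i := by
  unfold InverseAt at *
  rw [inv_inv]
  exact h.imp And.symm And.symm

theorem exists_inverseAt {n : ℕ} (w : SignedPerm n) (i : Fin n) : ∃ k, InverseAt w i k := by
  have hinv : ∀ x, (w⁻¹).1 (w.1 x) = x := fun x => w.1.symm_apply_apply x
  obtain ⟨k, hk | hk⟩ := eq_letter_or_neg (w.1 (letter i))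
  · refine ⟨k, Or.inl ⟨by rw [oneLine, hk]; rfl, ?_⟩⟩
    rw [oneLine, ← hk, hinv]
    rfl
  · have hk' : letter k = w.1 (letter i).neg := by rw [act_neg_apply, hk, SignedIdx.neg_neg]
    refine ⟨k, Or.inr ⟨by rw [oneLine, hk]; rfl, ?_⟩⟩
    rw [oneLine, hk', hinv]
    rfl

theorem exists_inverseAt_right {n : ℕ} (w : SignedPerm n) (k : Fin n) :
    ∃ i, InverseAt w i k := by
  obtain ⟨i, hi⟩ := exists_inverseAt w⁻¹ k
  exact ⟨i, by simpa using hi.inv⟩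

/-- A violation means opposite signs and decreasing absolute values, a configuration symmetric under
exchanging positions with absolute values. -/
theorem InverseAt.not_signedLe {n : ℕ} {w : SignedPerm n} {i j k l : Fin n}
    (hik : InverseAt w i k) (hjl : InverseAt w j l) (hij : i < j)
    (h : ¬ SignedLe (oneLine w i) (oneLine w j)) :
    l < k ∧ ¬ SignedLe (oneLine w⁻¹ l) (oneLine w⁻¹ k) := by
  unfold InverseAt at hik hjl
  unfold SignedLe at *
  rw [Fin.lt_def] at *
  omega

/-- Every signed word with letters in `[n]_±` is the one-line notation of a signed permutation. -/
theorem exists_oneLine_eq {n : ℕ} {a : Fin n → ℤ} (ha : IsSignedWord a)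
    (hle : ∀ i, (a i).natAbs ≤ n) : ∃ u : SignedPerm n, oneLine u = a := by
  have : Finite (SignedIdx n) := by
    refine Set.Finite.subset (Set.finite_Icc (-n : ℤ) n) ?_
    rintro x ⟨_, hx⟩
    exact abs_le.1 hx
  have hlt : ∀ x : SignedIdx n, x.1.natAbs - 1 < n := fun x => by
    have h1 := x.2.1
    have h2 := abs_le.1 x.2.2
    omega
  -- The odd extension of `a`; injectivity on a finite set makes it a permutation.
  let φ : SignedIdx n → SignedIdx n := fun x =>
    ⟨if 0 < x.1 then a ⟨x.1.natAbs - 1, hlt x⟩ else -a ⟨x.1.natAbs - 1, hlt x⟩, by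
      have := ha.ne_zero ⟨x.1.natAbs - 1, hlt x⟩
      split_ifs <;> omega, by
      have := hle ⟨x.1.natAbs - 1, hlt x⟩
      rw [abs_le]
      split_ifs <;> omega⟩
  have hφ : ∀ x, (φ x).1 =
      if 0 < x.1 then a ⟨x.1.natAbs - 1, hlt x⟩ else -a ⟨x.1.natAbs - 1, hlt x⟩ := fun x => rfl
  have hinj : Function.Injective φ := by
    intro x y hxy
    have hxy' := congrArg Subtype.val hxy
    rw [hφ, hφ] at hxy'
    have hx0 := x.2.1
    have hy0 := y.2.1
    rcases lt_trichotomy (x.1.natAbs - 1) (y.1.natAbs - 1) with h | h | h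
    · have h1 := ha.ne ⟨_, hlt x⟩ ⟨_, hlt y⟩ (Fin.lt_def.2 h)
      have h2 := ha.add_ne ⟨_, hlt x⟩ ⟨_, hlt y⟩ (Fin.lt_def.2 h)
      split_ifs at hxy' <;> omega
    · have h3 := ha.ne_zero ⟨_, hlt y⟩
      simp only [h] at hxy'
      apply Subtype.ext
      split_ifs at hxy' <;> omega
    · have h1 := ha.ne ⟨_, hlt y⟩ ⟨_, hlt x⟩ (Fin.lt_def.2 h)
      have h2 := ha.add_ne ⟨_, hlt y⟩ ⟨_, hlt x⟩ (Fin.lt_def.2 h)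
      split_ifs at hxy' <;> omega
  refine ⟨⟨Equiv.ofBijective φ (Finite.injective_iff_bijective.1 hinj), fun x => ?_⟩, ?_⟩
  · apply Subtype.ext
    simp only [Equiv.ofBijective_apply]
    change (φ x.neg).1 = -(φ x).1
    have hx0 := x.2.1
    rw [hφ, hφ]
    simp only [SignedIdx.neg, Int.natAbs_neg]
    split_ifs <;> omega
  · funext i
    simp only [oneLine, Equiv.ofBijective_apply]
    rw [hφ]
    have h1 : (0 : ℤ) < (letter i).1 := by simp only [letter]; omega
    rw [if_pos h1]
    congr 1

-- Standardization and the four-letter end patterns.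

theorem IsSts.natAbs_lt_iff {m : ℕ} {a b : Fin m → ℤ} (h : IsSts a b) {i j : Fin m}
    (hij : i < j) : (b i).natAbs < (b j).natAbs ↔ (a i).natAbs ≤ (a j).natAbs := by
  have := h.2 i j hij
  simp only [Int.abs_eq_natAbs, Nat.cast_lt, Nat.cast_le] at this
  exact this

theorem isSts_self {n : ℕ} {a : Fin n → ℤ} (ha : IsSignedWord a) : IsSts a a := by
  refine ⟨fun i => Iff.rfl, fun i j hij => ⟨le_of_lt, fun h => lt_of_le_of_ne h fun h' => ?_⟩⟩
  rcases abs_eq_abs.1 h' with h' | h'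
  · exact ha.ne i j hij h'
  · exact ha.add_ne i j hij (by omega)

theorem IsSts.signedLe {m : ℕ} {a b : Fin m → ℤ} (h : IsSts a b) (hb : IsSignedWord b)
    {i j : Fin m} (hij : i < j) (hle : SignedLe (b i) (b j)) : SignedLe (a i) (a j) := by
  have h1 := h.1 i
  have h2 := h.1 j
  have h3 := h.natAbs_lt_iff hij
  have h4 := hb.ne_zero i
  have h5 := hb.ne_zero j
  have h6 := hb.ne i j hij
  have h7 := hb.add_ne i j hij
  unfold SignedLe at *
  omega

theorem isSts_four {a b c d x y z t : ℤ} : IsSts ![a, b, c, d] ![x, y, z, t] ↔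
    ((x < 0 ↔ a < 0) ∧ (y < 0 ↔ b < 0) ∧ (z < 0 ↔ c < 0) ∧ (t < 0 ↔ d < 0)) ∧
    (x.natAbs < y.natAbs ↔ a.natAbs ≤ b.natAbs) ∧ (x.natAbs < z.natAbs ↔ a.natAbs ≤ c.natAbs) ∧
    (x.natAbs < t.natAbs ↔ a.natAbs ≤ d.natAbs) ∧ (y.natAbs < z.natAbs ↔ b.natAbs ≤ c.natAbs) ∧
    (y.natAbs < t.natAbs ↔ b.natAbs ≤ d.natAbs) ∧ (z.natAbs < t.natAbs ↔ c.natAbs ≤ d.natAbs) := by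
  simp only [IsSts, Int.abs_eq_natAbs, Nat.cast_lt, Nat.cast_le]
  simp [Fin.forall_fin_succ, and_assoc]

/-- The letters `w_j w_k w_l w_n` standardize to one of the patterns `±1 -4 -2 3`. -/
def EndPattern {n : ℕ} (f : Fin (n + 1) → ℤ) (j k l : Fin (n + 1)) : Prop :=
  0 < f (Fin.last n) ∧ f k < 0 ∧ f l < 0 ∧ (f j).natAbs < (f l).natAbs ∧
    (f l).natAbs < (f (Fin.last n)).natAbs ∧ (f (Fin.last n)).natAbs < (f k).natAbs

/-- The two patterns differ only in the sign of their first letter, so that sign is left free in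
`EndPattern`. -/
theorem endPattern_iff {n : ℕ} {f : Fin (n + 1) → ℤ} (hf : IsSignedWord f)
    {j k l : Fin (n + 1)} (hjk : j < k) (hkl : k < l) (hl : l < Fin.last n) :
    EndPattern f j k l ↔ 0 < f (Fin.last n) ∧
      ∃ p ∈ ({![-1, -4, -2, 3], ![1, -4, -2, 3]} : Set (Fin 4 → ℤ)),
        IsSts ![f j, f k, f l, f (Fin.last n)] p := by
  have n1 := hf.ne_zero j
  have n2 := hf.ne j l (hjk.trans hkl)
  have n3 := hf.add_ne j l (hjk.trans hkl)
  have n4 := hf.ne l _ hl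
  have n5 := hf.add_ne l _ hl
  have n6 := hf.ne k _ (hkl.trans hl)
  have n7 := hf.add_ne k _ (hkl.trans hl)
  unfold EndPattern
  simp only [Set.mem_insert_iff, Set.mem_singleton_iff, exists_eq_or_imp, exists_eq_left,
    isSts_four]
  omega

theorem endPattern_neg_iff {n : ℕ} {f : Fin (n + 1) → ℤ} (hf : IsSignedWord f)
    {j k l : Fin (n + 1)} (hjk : j < k) (hkl : k < l) (hl : l < Fin.last n) :
    EndPattern (-f) j k l ↔ f (Fin.last n) < 0 ∧
      ∃ p ∈ ({![1, 4, 2, -3], ![-1, 4, 2, -3]} : Set (Fin 4 → ℤ)),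
        IsSts ![f j, f k, f l, f (Fin.last n)] p := by
  have n1 := hf.ne_zero j
  have n2 := hf.ne j l (hjk.trans hkl)
  have n3 := hf.add_ne j l (hjk.trans hkl)
  have n4 := hf.ne l _ hl
  have n5 := hf.add_ne l _ hl
  have n6 := hf.ne k _ (hkl.trans hl)
  have n7 := hf.add_ne k _ (hkl.trans hl)
  unfold EndPattern
  simp only [Set.mem_insert_iff, Set.mem_singleton_iff, exists_eq_or_imp, exists_eq_left,
    isSts_four, Pi.neg_apply]
  omega

-- Forbidden patterns in the inverse.

/-- The position of a letter, with the sign of the letter: the corresponding letter of the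
inverse. -/
def signedPos {n : ℕ} (f : Fin n → ℤ) (i : Fin n) : ℤ := if 0 < f i then (i : ℤ) + 1 else -(i + 1)

theorem signedPos_neg {n : ℕ} {f : Fin n → ℤ} (hf : IsSignedWord f) (i : Fin n) :
    signedPos (-f) i = -signedPos f i := by
  have := hf.ne_zero i
  simp only [signedPos, Pi.neg_apply]
  split_ifs <;> omega

theorem InverseAt.eq_signedPos {n : ℕ} {w : SignedPerm n} {i k : Fin n} (h : InverseAt w i k) :
    oneLine w⁻¹ k = signedPos (oneLine w) i := by
  unfold InverseAt at h
  unfold signedPos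
  split_ifs <;> omega

/-- Constraints on the positions `a, b, c, d` of four letters of increasing absolute value, with
`A, B, C, D` saying which of them are negative, that exclude the pattern `3142` in the inverse. -/
theorem false_of_signed_positions {n a b c d : ℕ} {A B C D : Prop} [Decidable A] [Decidable B]
    [Decidable C] [Decidable D] (nac : a ≠ c) (nad : a ≠ d) (nbc : b ≠ c)
    (nbd : b ≠ d) (ncd : c ≠ d) (lb : b ≤ n) (lc : c ≤ n)
    (uab : b < a → (A ↔ B)) (ubc : c < b → (B ↔ C))
    (uad : a < n → d < a → (A ↔ D)) (ubd : b < n → d < b → (B ↔ D))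
    (ucd : c < n → d < c → (C ↔ D))
    (s1 : ¬A → ¬B → ¬C → ¬D → ¬(b < d ∧ d < a ∧ a < c))
    (s2 : A → B → C → D → ¬(c < a ∧ a < d ∧ d < b))
    (s3 : B → ¬C → D → c = n → ¬(a < d ∧ d < b ∧ b < n))
    (h1 : (if B then -((b : ℤ) + 1) else b + 1) < if D then -((d : ℤ) + 1) else d + 1)
    (h2 : (if D then -((d : ℤ) + 1) else d + 1) < if A then -((a : ℤ) + 1) else a + 1)
    (h3 : (if A then -((a : ℤ) + 1) else a + 1) < if C then -((c : ℤ) + 1) else c + 1) :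
    False := by
  -- By `h1`–`h3`, in the order `b, d, a, c` the negative ones come first. None or all negative
  -- contradicts `s1` or `s2`. If only `b` is negative, `uab`, `ubc` and `ubd` clash. The negative
  -- sets `{b, d}` and `{b, d, a}` force `a < d < b < c = n`, against `s3`.
  grind

/-- When absolute values decrease from an earlier to a later position, `SignedLe` forces equal
signs. Pairs among `a, b, c` miss the maximal letter, so `hU` applies to them; pairs involving `d`
rely on `hB` and need the other position to precede the last. -/
theorem not_signedPos_pattern {n : ℕ} {f : Fin (n + 1) → ℤ} (hf : IsSignedWord f)
    (hle : ∀ i, (f i).natAbs ≤ n + 1)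
    (hA : ∀ p q r s, p < q → q < r → r < s → Avoids f p q r s)
    (hB : ∀ i j, i < j → j < Fin.last n → SignedLe (f i) (f j))
    (hU : ∀ i j, i < j → (f i).natAbs ≤ n → (f j).natAbs ≤ n → SignedLe (f i) (f j))
    (hE : ∀ j k l, j < k → k < l → l < Fin.last n → ¬ EndPattern f j k l)
    {a b c d : Fin (n + 1)} (hab : (f a).natAbs < (f b).natAbs)
    (hbc : (f b).natAbs < (f c).natAbs) (hcd : (f c).natAbs < (f d).natAbs) :
    ¬ (signedPos f b < signedPos f d ∧ signedPos f d < signedPos f a ∧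
      signedPos f a < signedPos f c) := by
  have hd := hle d
  have za := hf.ne_zero a
  have zb := hf.ne_zero b
  have zc := hf.ne_zero c
  have zd := hf.ne_zero d
  have same : ∀ {i j}, (f i).natAbs < (f j).natAbs → (j < i → SignedLe (f j) (f i)) → j < i →
      (f i < 0 ↔ f j < 0) := fun {i j} h h' hji => by
    have := h' hji
    have := hf.ne_zero i
    have := hf.ne_zero j
    unfold SignedLe at *
    omega
  have uab := same hab fun h => hU b a h (by omega) (by omega)
  have ubc := same hbc fun h => hU c b h (by omega) (by omega)
  have uad : a < Fin.last n → d < a → (f a < 0 ↔ f d < 0) := fun h =>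
    same (hab.trans (hbc.trans hcd)) fun h' => hB d a h' h
  have ubd : b < Fin.last n → d < b → (f b < 0 ↔ f d < 0) := fun h =>
    same (hbc.trans hcd) fun h' => hB d b h' h
  have ucd : c < Fin.last n → d < c → (f c < 0 ↔ f d < 0) := fun h =>
    same hcd fun h' => hB d c h' h
  -- With all signs equal, the inverse pattern 3142 comes from a 2413 in the word itself.
  have s1 : ¬ f a < 0 → ¬ f b < 0 → ¬ f c < 0 → ¬ f d < 0 → ¬ (b < d ∧ d < a ∧ a < c) := by
    rintro h4 h5 h6 h7 ⟨h8, h9, h10⟩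
    have := (hA b d a c h8 h9 h10).1
    omega
  have s2 : f a < 0 → f b < 0 → f c < 0 → f d < 0 → ¬ (c < a ∧ a < d ∧ d < b) := by
    rintro h4 h5 h6 h7 ⟨h8, h9, h10⟩
    have := (hA c a d b h8 h9 h10).1
    omega
  have s3 : f b < 0 → ¬ f c < 0 → f d < 0 → c = Fin.last n →
      ¬ (a < d ∧ d < b ∧ b < Fin.last n) := by
    rintro h4 h5 h6 rfl ⟨h7, h8, h9⟩
    have := hE a d b h7 h8 h9
    unfold EndPattern at this
    omega
  have ne : ∀ {i j}, (f i).natAbs < (f j).natAbs → i ≠ j := fun {i j} h h' => by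
    rw [h'] at h; omega
  have nac := ne (hab.trans hbc)
  have nad := ne (hab.trans (hbc.trans hcd))
  have nbc := ne hbc
  have nbd := ne (hbc.trans hcd)
  have ncd := ne hcd
  have eq : ∀ i, signedPos f i = if f i < 0 then -((i : ℤ) + 1) else i + 1 := fun i => by
    have := hf.ne_zero i
    unfold signedPos
    split_ifs <;> omega
  rintro ⟨h1, h2, h3⟩
  rw [eq, eq] at h1 h2 h3
  exact false_of_signed_positions (Fin.val_ne_of_ne nac)
    (Fin.val_ne_of_ne nad) (Fin.val_ne_of_ne nbc) (Fin.val_ne_of_ne nbd) (Fin.val_ne_of_ne ncd)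
    (Fin.le_last b) (Fin.le_last c) uab ubc uad ubd ucd s1 s2
    (fun h4 h5 h6 h7 => s3 h4 h5 h6 (Fin.ext h7)) h1 h2 h3

/-- A 2413 in the inverse is a 3142 for the negated word, so one exclusion applied to the word and
to its negative covers both patterns. -/
theorem avoids_inv {n : ℕ} {w : SignedPerm (n + 1)}
    (hA : ∀ p q r s, p < q → q < r → r < s → Avoids (oneLine w) p q r s)
    (hB : ∀ i j, i < j → j < Fin.last n → SignedLe (oneLine w i) (oneLine w j))
    (hU : ∀ i j, i < j → (oneLine w i).natAbs ≤ n → (oneLine w j).natAbs ≤ n →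
      SignedLe (oneLine w i) (oneLine w j))
    (hE : ∀ j k l, j < k → k < l → l < Fin.last n →
      ¬ EndPattern (oneLine w) j k l ∧ ¬ EndPattern (-oneLine w) j k l)
    (p q r s : Fin (n + 1)) (hpq : p < q) (hqr : q < r) (hrs : r < s) :
    Avoids (oneLine w⁻¹) p q r s := by
  obtain ⟨a, ha⟩ := exists_inverseAt_right w p
  obtain ⟨b, hb⟩ := exists_inverseAt_right w q
  obtain ⟨c, hc⟩ := exists_inverseAt_right w r
  obtain ⟨d, hd⟩ := exists_inverseAt_right w s
  have hf := isSignedWord_oneLine w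
  have lt : ∀ {i j k l}, InverseAt w i k → InverseAt w j l → k < l →
      (oneLine w i).natAbs < (oneLine w j).natAbs := fun {i j k l} h1 h2 h => by
    unfold InverseAt at h1 h2
    rw [Fin.lt_def] at h
    omega
  have hab := lt ha hb hpq
  have hbc := lt hb hc hqr
  have hcd := lt hc hd hrs
  have k1 := not_signedPos_pattern hf (natAbs_oneLine_le w) hA hB hU
    (fun j k l h1 h2 h3 => (hE j k l h1 h2 h3).1) hab hbc hcd
  have k2 := not_signedPos_pattern (f := -oneLine w) (a := a) (b := b) (c := c) (d := d) hf.neg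
    (fun i => by simpa using natAbs_oneLine_le w i)
    (fun p q r s h1 h2 h3 => (hA p q r s h1 h2 h3).neg)
    (fun i j h1 h2 => (hB i j h1 h2).neg)
    (fun i j h1 h2 h3 => (hU i j h1 (by simpa using h2) (by simpa using h3)).neg)
    (fun j k l h1 h2 h3 => (hE j k l h1 h2 h3).2)
    (by simpa using hab) (by simpa using hbc) (by simpa using hcd)
  simp only [signedPos_neg hf] at k2
  unfold Avoids
  rw [ha.eq_signedPos, hb.eq_signedPos, hc.eq_signedPos, hd.eq_signedPos]
  omega

theorem not_endPattern {n : ℕ} {w : SignedPerm (n + 1)}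
    (hA : ∀ p q r s, p < q → q < r → r < s → Avoids (oneLine w⁻¹) p q r s)
    {j k l : Fin (n + 1)} (hjk : j < k) (hkl : k < l) (hl : l < Fin.last n) :
    ¬ EndPattern (oneLine w) j k l ∧ ¬ EndPattern (-oneLine w) j k l := by
  -- By absolute value the letters are ordered `j, l, last, k`. The inverse has signs `±, -, +, -`
  -- there, giving 3142; the negated pattern gives 2413.
  obtain ⟨p, hp⟩ := exists_inverseAt w j
  obtain ⟨q, hq⟩ := exists_inverseAt w l
  obtain ⟨r, hr⟩ := exists_inverseAt w (Fin.last n)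
  obtain ⟨s, hs⟩ := exists_inverseAt w k
  have h : p < q → q < r → r < s → Avoids (oneLine w⁻¹) p q r s := hA p q r s
  unfold InverseAt at hp hq hr hs
  unfold Avoids at h
  unfold EndPattern
  simp only [Fin.lt_def, Fin.val_last, Pi.neg_apply] at *
  omega

end TypeB

-- The lemma.

theorem lemma3p7 (n : ℕ) (w : TypeB.SignedPerm (n + 1)) (hw : TypeB.MinimalNonseparable w) :
    TypeB.MinimalNonseparable w⁻¹ ↔
      (∃ i : Fin (n + 1), i < Fin.last n ∧ |TypeB.oneLine w i| = (n : ℤ) + 1 ∧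
        ∃ u : TypeB.SignedPerm n,
          TypeB.IsSts (fun k : Fin n => TypeB.oneLine w (i.succAbove k)) (TypeB.oneLine u) ∧
          TypeB.Separable u) ∧
      (∀ j k l : Fin (n + 1), j < k → k < l → l < Fin.last n →
        (0 < TypeB.oneLine w (Fin.last n) →
          ∀ p ∈ ({![-1, -4, -2, 3], ![1, -4, -2, 3]} : Set (Fin 4 → ℤ)),
            ¬ TypeB.IsSts ![TypeB.oneLine w j, TypeB.oneLine w k, TypeB.oneLine w l,
              TypeB.oneLine w (Fin.last n)] p) ∧
        (TypeB.oneLine w (Fin.last n) < 0 →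
          ∀ p ∈ ({![1, 4, 2, -3], ![-1, 4, 2, -3]} : Set (Fin 4 → ℤ)),
            ¬ TypeB.IsSts ![TypeB.oneLine w j, TypeB.oneLine w k, TypeB.oneLine w l,
              TypeB.oneLine w (Fin.last n)] p)) := by
  open TypeB in
  have hf := isSignedWord_oneLine w
  rw [minimalNonseparable_iff] at hw
  obtain ⟨hA, hB, a, b, hab, hnot⟩ := hw
  have hend : ∀ j k l : Fin (n + 1), j < k → k < l → l < Fin.last n →
      ((¬ EndPattern (oneLine w) j k l ∧ ¬ EndPattern (-oneLine w) j k l) ↔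
        (0 < oneLine w (Fin.last n) →
          ∀ p ∈ ({![-1, -4, -2, 3], ![1, -4, -2, 3]} : Set (Fin 4 → ℤ)),
            ¬ IsSts ![oneLine w j, oneLine w k, oneLine w l, oneLine w (Fin.last n)] p) ∧
        (oneLine w (Fin.last n) < 0 →
          ∀ p ∈ ({![1, 4, 2, -3], ![-1, 4, 2, -3]} : Set (Fin 4 → ℤ)),
            ¬ IsSts ![oneLine w j, oneLine w k, oneLine w l, oneLine w (Fin.last n)] p)) :=
    fun j k l h1 h2 h3 => by
      rw [endPattern_iff hf h1 h2 h3, endPattern_neg_iff hf h1 h2 h3]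
      push Not
      rfl
  rw [minimalNonseparable_iff]
  constructor
  · rintro ⟨hA', hB', -⟩
    refine ⟨?_, fun j k l h1 h2 h3 => (hend j k l h1 h2 h3).1 (not_endPattern hA' h1 h2 h3)⟩
    obtain ⟨i, hi⟩ := exists_inverseAt_right w (Fin.last n)
    have hmax : (oneLine w i).natAbs = n + 1 := by
      unfold InverseAt at hi
      rw [Fin.val_last] at hi
      omega
    have hlt : ∀ k, k ≠ i → (oneLine w k).natAbs ≤ n := fun k hk => by
      have h1 := natAbs_oneLine_le w k
      by_contra h
      rcases lt_or_gt_of_ne hk with h' | h'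
      · have := hf.ne k i h'
        have := hf.add_ne k i h'
        omega
      · have := hf.ne i k h'
        have := hf.add_ne i k h'
        omega
    refine ⟨i, ?_, by rw [Int.abs_eq_natAbs, hmax]; push_cast; rfl, ?_⟩
    -- The defect of `w` ends at the last position and starts with a letter of larger absolute
    -- value, so the last letter is not maximal.
    · refine lt_of_le_of_ne (Fin.le_last i) ?_
      rintro rfl
      have hb : b = Fin.last n := by
        by_contra h
        exact hnot (hB a b hab (lt_of_le_of_ne (Fin.le_last b) h))
      have := natAbs_oneLine_le w a
      subst hb
      unfold SignedLe at hnot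
      omega
    · have hword : IsSignedWord fun k => oneLine w (i.succAbove k) :=
        ⟨fun k => hf.ne_zero _, fun k l h => hf.ne _ _ (Fin.strictMono_succAbove i h),
          fun k l h => hf.add_ne _ _ (Fin.strictMono_succAbove i h)⟩
      -- Without the maximal letter the word already lies in `𝔅_n`, so standardization leaves it
      -- unchanged.
      obtain ⟨u, hu⟩ := exists_oneLine_eq hword fun k => hlt _ (Fin.succAbove_ne i k)
      refine ⟨u, by rw [hu]; exact isSts_self hword, ?_⟩
      rw [separable_iff, patternSeparable_univ, hu]
      have hmono := Fin.strictMono_succAbove i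
      refine ⟨fun p q r s h1 h2 h3 => hA _ _ _ _ (hmono h1) (hmono h2) (hmono h3),
        fun p q hpq => ?_⟩
      -- A defect avoiding the maximal letter would become a defect of `w⁻¹` before its last
      -- position.
      by_contra h
      obtain ⟨k, hk⟩ := exists_inverseAt w (i.succAbove p)
      obtain ⟨l, hl⟩ := exists_inverseAt w (i.succAbove q)
      obtain ⟨h1, h2⟩ := hk.not_signedLe hl (hmono hpq) h
      refine h2 (hB' l k h1 ?_)
      have := hlt _ (Fin.succAbove_ne i p)
      unfold InverseAt at hk
      rw [Fin.lt_def, Fin.val_last]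
      omega
  · rintro ⟨⟨i, -, hmax, u, hu, hsep⟩, hE⟩
    rw [separable_iff, patternSeparable_univ] at hsep
    rw [Int.abs_eq_natAbs] at hmax
    -- Positions with non-maximal letters are those in the image of `i.succAbove`, where
    -- separability of `u` applies.
    have hU : ∀ p q, p < q → (oneLine w p).natAbs ≤ n → (oneLine w q).natAbs ≤ n →
        SignedLe (oneLine w p) (oneLine w q) := by
      intro p q hpq hp hq
      obtain ⟨p, rfl⟩ := Fin.exists_succAbove_eq (x := p) (y := i) fun h => by
        rw [h] at hp; omega
      obtain ⟨q, rfl⟩ := Fin.exists_succAbove_eq (x := q) (y := i) fun h => by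
        rw [h] at hq; omega
      have hpq' := (Fin.strictMono_succAbove i).lt_iff_lt.1 hpq
      exact hu.signedLe (isSignedWord_oneLine u) hpq' (hsep.2 p q hpq')
    refine ⟨avoids_inv hA hB hU fun j k l h1 h2 h3 =>
      (hend j k l h1 h2 h3).2 (hE j k l h1 h2 h3), fun k l hkl hl => ?_, ?_⟩
    -- A defect of `w⁻¹` before its last position comes from two non-maximal letters of `w`,
    -- contrary to `hU`.
    · by_contra h
      obtain ⟨p, hp⟩ := exists_inverseAt_right w k
      obtain ⟨q, hq⟩ := exists_inverseAt_right w l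
      obtain ⟨h1, h2⟩ := hp.inv.not_signedLe hq.inv hkl h
      rw [inv_inv] at h2
      refine h2 (hU q p h1 ?_ ?_)
      · unfold InverseAt at hq
        rw [Fin.lt_def, Fin.val_last] at hl
        omega
      · unfold InverseAt at hp
        rw [Fin.lt_def] at hl hkl
        rw [Fin.val_last] at hl
        omega
    · obtain ⟨k, hk⟩ := exists_inverseAt w a
      obtain ⟨l, hl⟩ := exists_inverseAt w b
      exact ⟨l, k, hk.not_signedLe hl hab hnot⟩
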